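/- Let $\mathbb{K}$ be a field of characteristic $0$. For $n\ge 0$ let $\mathbf{B}_n$ be the braid group on $n$ strands, $\mathbf{PB}_n=\ker(\mathbf{B}_n\to\mathfrak{S}_n)$ the pure braid group, $\boldsymbol{\beta}$ the braid groupoid (objects the natural numbers, $\mathrm{Aut}(n)=\mathbf{B}_n$, no other morphisms) with the strict monoidal product $\natural$ given by addition on objects and by laying braids side by side. Let $\mathfrak{U}\boldsymbol{\beta}$ be Quillen's bracket construction: its objects are the natural numbers, a morphism $m\to n$ is a class $[X,f]$ of pairs with $f\colon X\natural m\to n$ in $\boldsymbol{\beta}$ (so $X+m=n$ and $f\in\mathbf{B}_n$), where $[X,f\circ(g\,\natural\,\mathrm{id}_m)]=[X,f]$ for $g\in\mathbf{B}_X$, and $[Y,g]\circ[X,f]=[Y\natural X,\,g\circ(\mathrm{id}_Y\natural f)]$. Let $FI$ be the category of finite sets and injections (in its skeletal form, with objects the natural numbers), and $\mathfrak{P}\colon\mathfrak{U}\boldsymbol{\beta}\to FI$ the functor that is the identity on objects and is induced by the surjections $\mathbf{B}_n\to\mathfrak{S}_n$. Let $F\colon\mathfrak{U}\boldsymbol{\beta}\to\mathbb{K}\text{-}\mathfrak{Mod}$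 be a functor and $q\ge 0$. Denote $$H_q(\mathbf{B}_\infty,F_\infty)=\operatorname*{colim}_{n\in(\mathbb{N},\le)}H_q(\mathbf{B}_n,F(n)),$$ where the transition map from $n$ to $n+1$ is induced by $\mathrm{id}_1\natural-\colon\mathbf{B}_n\to\mathbf{B}_{n+1}$ and $F([1,\mathrm{id}_{n+1}])$. The groups $H_q(\mathbf{PB}_n,F(n))$ form a functor $FI\to\mathbb{K}\text{-}\mathfrak{Mod}$: the injection $\mathfrak{P}([X,f])\colon m\to n$ acts by the map induced by $\mathbf{PB}_m\to\mathbf{PB}_n$, $x\mapsto f(\mathrm{id}_X\natural x)f^{-1}$, and $F([X,f])\colon F(m)\to F(n)$. Then there is an isomorphism of $\mathbb{K}$-modules $$H_q(\mathbf{B}_\infty,F_\infty)\;\cong\;\operatorname*{colim}_{n\in FI}H_q(\mathbf{PB}_n,F(n)).$$ If moreover $F$ factors through $\mathfrak{P}$, i.e. $F\cong G\circ\mathfrak{P}$ for a functor $G\colon FI\to\mathbb{K}\text{-}\mathfrak{Mod}$, then $$H_q(\mathbf{B}_\infty,F_\infty)\;\cong\;\operatorname*{colim}_{n\in FI}\bigl(H_q(\mathbf{PB}_n,\mathbb{K})\otimes_{\mathbb{K}}G(n)\bigr),$$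 where $\mathbb{K}$ is the trivial module and the tensor product of functors on $FI$ is taken objectwise. -/

import Mathlib

universe u

open CategoryTheory CategoryTheory.Limits MonoidalCategory

/-! ### Braid groups -/

/-- The Artin relations on `n` strands, in the generators indexed by `Fin (n - 1)`:
`σᵢ σⱼ = σⱼ σᵢ` for `i + 1 < j`, and `σᵢ σⱼ σᵢ = σⱼ σᵢ σⱼ` for `j = i + 1`. -/
def braidRels (n : ℕ) : Set (FreeGroup (Fin (n - 1))) :=
  {r | ∃ i j : Fin (n - 1), (i : ℕ) + 1 < j ∧
    r = FreeGroup.of i * FreeGroup.of j * (FreeGroup.of j * FreeGroup.of i)⁻¹} ∪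
  {r | ∃ i j : Fin (n - 1), (i : ℕ) + 1 = j ∧
    r = FreeGroup.of i * FreeGroup.of j * FreeGroup.of i *
      (FreeGroup.of j * FreeGroup.of i * FreeGroup.of j)⁻¹}

/-- The braid group on `n` strands (Artin's presentation). It is trivial for `n ≤ 1`. -/
def BraidGroup (n : ℕ) : Type := PresentedGroup (braidRels n)

instance (n : ℕ) : Group (BraidGroup n) :=
  inferInstanceAs (Group (PresentedGroup (braidRels n)))

namespace BraidGroup

/-- The Artin generators. -/
def σ {n : ℕ} (i : Fin (n - 1)) : BraidGroup n := PresentedGroup.of i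

theorem σ_comm {n : ℕ} (i j : Fin (n - 1)) (h : (i : ℕ) + 1 < j) :
    (σ i * σ j : BraidGroup n) = σ j * σ i :=
  PresentedGroup.mk_eq_mk_of_mul_inv_mem (Or.inl ⟨i, j, h, rfl⟩)

theorem σ_braid {n : ℕ} (i j : Fin (n - 1)) (h : (i : ℕ) + 1 = j) :
    (σ i * σ j * σ i : BraidGroup n) = σ j * σ i * σ j :=
  PresentedGroup.mk_eq_mk_of_mul_inv_mem (Or.inr ⟨i, j, h, rfl⟩)

/-- The universal property of the Artin presentation. -/
def lift {n : ℕ} {H : Type*} [Group H] (s : Fin (n - 1) → H)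
    (hc : ∀ i j : Fin (n - 1), (i : ℕ) + 1 < j → s i * s j = s j * s i)
    (hb : ∀ i j : Fin (n - 1), (i : ℕ) + 1 = j → s i * s j * s i = s j * s i * s j) :
    BraidGroup n →* H :=
  PresentedGroup.toGroup (rels := braidRels n) (f := s) <| by
    rintro r (⟨i, j, h, rfl⟩ | ⟨i, j, h, rfl⟩)
    · simpa only [map_mul, map_inv, FreeGroup.lift_apply_of, mul_inv_eq_one] using hc i j h
    · simpa only [map_mul, map_inv, FreeGroup.lift_apply_of, mul_inv_eq_one] using hb i j h

@[simp]
theorem lift_σ {n : ℕ} {H : Type*} [Group H] (s : Fin (n - 1) → H) (hc) (hb) (i : Fin (n - 1)) :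
    lift s hc hb (σ i) = s i :=
  PresentedGroup.toGroup.of _

theorem hom_ext {n : ℕ} {H : Type*} [Group H] {φ ψ : BraidGroup n →* H}
    (h : ∀ i, φ (σ i) = ψ (σ i)) : φ = ψ :=
  PresentedGroup.ext (rels := braidRels n) h

theorem closure_σ (n : ℕ) : Subgroup.closure (Set.range (σ (n := n))) = ⊤ :=
  PresentedGroup.closure_range_of (braidRels n)

/-- For `a + m ≤ n`, the homomorphism `σᵢ ↦ σ_{a+i}`, which places a braid on `m` strands on the
strands `a, …, a + m - 1` of the trivial braid on `n` strands. If `k + m = n`, then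
`shift 0 : BraidGroup k →* BraidGroup n` is `g ↦ g ♮ id_m` and
`shift k : BraidGroup m →* BraidGroup n` is `g ↦ id_k ♮ g`, where `♮` lays two braids side by
side. -/
def shift {m n : ℕ} (a : ℕ) (h : a + m ≤ n) : BraidGroup m →* BraidGroup n :=
  lift (fun i => σ ⟨a + i, by omega⟩)
    (fun i j hij => σ_comm _ _ (by simp only; omega))
    (fun i j hij => σ_braid _ _ (by simp only; omega))

@[simp]
theorem shift_σ {m n : ℕ} (a : ℕ) (h : a + m ≤ n) (i : Fin (m - 1)) :
    shift a h (σ i) = σ ⟨a + i, by omega⟩ :=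
  lift_σ _ _ _ _

theorem shift_shift {l m n : ℕ} (a b : ℕ) (ha : a + l ≤ m) (hb : b + m ≤ n) (x : BraidGroup l) :
    shift b hb (shift a ha x) = shift (b + a) (by omega : b + a + l ≤ n) x := by
  refine DFunLike.congr_fun (f := (shift b hb).comp (shift a ha)) (hom_ext fun i => ?_) x
  simp [add_assoc]

@[simp]
theorem shift_self {n : ℕ} (h : 0 + n ≤ n) (x : BraidGroup n) : shift 0 h x = x := by
  refine DFunLike.congr_fun (g := MonoidHom.id _) (hom_ext fun i => ?_) x
  simp

theorem shift_comm {l m n : ℕ} (a b : ℕ) (ha : a + l ≤ b) (hb : b + m ≤ n)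
    (x : BraidGroup l) (y : BraidGroup m) :
    shift a (by omega : a + l ≤ n) x * shift b hb y =
      shift b hb y * shift a (by omega : a + l ≤ n) x := by
  have hx : x ∈ Subgroup.closure (Set.range (σ (n := l))) := by rw [closure_σ]; trivial
  have hy : y ∈ Subgroup.closure (Set.range (σ (n := m))) := by rw [closure_σ]; trivial
  change Commute _ _
  induction hx using Subgroup.closure_induction with
  | one => rw [map_one]; exact Commute.one_left _
  | mul _ _ _ _ h1 h2 => rw [map_mul]; exact h1.mul_left h2
  | inv _ _ h1 => rw [map_inv]; exact h1.inv_left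
  | mem x hx =>
    obtain ⟨i, rfl⟩ := hx
    induction hy using Subgroup.closure_induction with
    | one => rw [map_one]; exact Commute.one_right _
    | mul _ _ _ _ h1 h2 => rw [map_mul]; exact h1.mul_right h2
    | inv _ _ h1 => rw [map_inv]; exact h1.inv_right
    | mem y hy =>
      obtain ⟨j, rfl⟩ := hy
      rw [shift_σ, shift_σ]
      exact σ_comm _ _ (by simp only; omega)

/-- The canonical surjection onto the symmetric group; it sends `σᵢ` to the transposition
`(i, i + 1)` of `{0, …, n - 1}`. -/
def toPerm (n : ℕ) : BraidGroup n →* Equiv.Perm (Fin n) :=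
  lift (fun i => Equiv.swap ⟨i, by omega⟩ ⟨i + 1, by omega⟩)
    (fun i j hij => by
      refine (Equiv.Perm.Disjoint.commute ?_).eq
      intro x
      by_cases hx : (x : ℕ) = i ∨ (x : ℕ) = i + 1
      · right
        apply Equiv.swap_apply_of_ne_of_ne <;> simp only [ne_eq, Fin.ext_iff] <;> omega
      · left
        apply Equiv.swap_apply_of_ne_of_ne <;> simp only [ne_eq, Fin.ext_iff] <;> omega)
    (fun i j hij => by
      have hj : (⟨j, by omega⟩ : Fin n) = ⟨i + 1, by omega⟩ := Fin.ext hij.symm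
      rw [hj]
      have h1 : (⟨i, by omega⟩ : Fin n) ≠ ⟨i + 1, by omega⟩ := by simp
      have h2 : (⟨i + 1, by omega⟩ : Fin n) ≠ ⟨j + 1, by omega⟩ := by
        simp only [ne_eq, Fin.ext_iff]; omega
      have h3 : (⟨i, by omega⟩ : Fin n) ≠ ⟨j + 1, by omega⟩ := by
        simp only [ne_eq, Fin.ext_iff]; omega
      rw [Equiv.swap_mul_swap_mul_swap h1 h3, Equiv.swap_comm (⟨i, _⟩ : Fin n) ⟨i + 1, _⟩,
        Equiv.swap_comm (⟨i + 1, _⟩ : Fin n) ⟨j + 1, _⟩,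
        Equiv.swap_mul_swap_mul_swap h2.symm h3.symm, Equiv.swap_comm])

theorem toPerm_σ {n : ℕ} (i : Fin (n - 1)) :
    toPerm n (σ i) = Equiv.swap ⟨i, by omega⟩ ⟨i + 1, by omega⟩ :=
  lift_σ _ _ _ _

theorem toPerm_shift_of_lt {m n : ℕ} (a : ℕ) (h : a + m ≤ n) (x : BraidGroup m) (p : Fin n)
    (hp : (p : ℕ) < a ∨ a + m ≤ p) : toPerm n (shift a h x) p = p := by
  have hx : x ∈ Subgroup.closure (Set.range (σ (n := m))) := by rw [closure_σ]; trivial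
  induction hx using Subgroup.closure_induction with
  | one => simp
  | mul _ _ _ _ h1 h2 => simp [h1, h2]
  | inv _ _ h1 => rw [map_inv, map_inv, Equiv.Perm.inv_eq_iff_eq]; exact h1.symm
  | mem x hx =>
    obtain ⟨i, rfl⟩ := hx
    rw [shift_σ, toPerm_σ]
    apply Equiv.swap_apply_of_ne_of_ne <;> simp only [ne_eq, Fin.ext_iff] <;> omega

theorem toPerm_shift {m n : ℕ} (a : ℕ) (h : a + m ≤ n) (x : BraidGroup m) (j : Fin m) :
    toPerm n (shift a h x) ⟨a + j, by omega⟩ = ⟨a + toPerm m x j, by omega⟩ := by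
  have hx : x ∈ Subgroup.closure (Set.range (σ (n := m))) := by rw [closure_σ]; trivial
  induction hx using Subgroup.closure_induction generalizing j with
  | one => simp
  | mul _ _ _ _ h1 h2 => simp [h1, h2]
  | inv x _ h1 =>
    rw [map_inv, map_inv, Equiv.Perm.inv_eq_iff_eq, h1]
    simp
  | mem x hx =>
    obtain ⟨i, rfl⟩ := hx
    rw [shift_σ]
    simp only [toPerm_σ, Equiv.swap_apply_def, Fin.ext_iff]
    split_ifs <;> dsimp only <;> omega

theorem toPerm_surjective (n : ℕ) : Function.Surjective (toPerm n) := by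
  cases n with
  | zero => intro p; exact ⟨1, Subsingleton.elim _ _⟩
  | succ n =>
    intro p
    have hp : p ∈ Submonoid.closure
        (Set.range fun i : Fin n ↦ Equiv.swap i.castSucc i.succ) := by
      rw [Equiv.Perm.mclosure_swap_castSucc_succ]; trivial
    induction hp using Submonoid.closure_induction with
    | one => exact ⟨1, map_one _⟩
    | mul _ _ _ _ h1 h2 =>
      obtain ⟨x, rfl⟩ := h1
      obtain ⟨y, rfl⟩ := h2
      exact ⟨x * y, map_mul _ _ _⟩
    | mem _ hp =>
      obtain ⟨i, rfl⟩ := hp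
      exact ⟨σ (n := n + 1) i, toPerm_σ (n := n + 1) i⟩

end BraidGroup

/-- The pure braid group on `n` strands, the kernel of `BraidGroup n →* 𝔖ₙ`. -/
def PureBraidGroup (n : ℕ) : Subgroup (BraidGroup n) := (BraidGroup.toPerm n).ker

/-! ### The categories `FI` and `𝔘β` -/

/-- Objects of the (skeleton of the) category of finite sets and injections: the natural numbers,
`n` standing for `{0, …, n - 1}`. -/
structure FI where
  /-- the cardinality -/
  card : ℕ

/-- Morphisms `m ⟶ n` of `FI` are the injections `{0, …, m - 1} ↪ {0, …, n - 1}`. -/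
instance : SmallCategory FI where
  Hom m n := Fin m.card ↪ Fin n.card
  id _ := Function.Embedding.refl _
  comp f g := f.trans g

/-- A pair `(X, f)` of an object `X` and a morphism `f : X ♮ m ⟶ n` of the braid groupoid `β`.
As `β` has the natural numbers as objects, the braid groups as automorphism groups and no other
morphisms, and `X ♮ m = X + m`, this is a number `X` with `X + m = n` and a braid on `n`
strands. -/
structure BracketPair (m n : ℕ) where
  /-- the complementing object -/
  X : ℕ
  /-- source and target agree -/
  add_eq : X + m = n
  /-- the morphism of `β` -/
  f : BraidGroup n

namespace BracketPair

/-- Two pairs define the same element of `colim_{X ∈ β} Hom_β (X ♮ m, n)` if they differ by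
precomposition with `g ♮ id_m` for some morphism `g` of `β`. -/
instance setoid (m n : ℕ) : Setoid (BracketPair m n) where
  r P Q := ∃ g : BraidGroup P.X,
    P.f = Q.f * BraidGroup.shift 0 (by have := P.add_eq; omega : 0 + P.X ≤ n) g
  iseqv :=
    { refl := fun P => ⟨1, by simp⟩
      symm := by
        rintro ⟨X, hX, f⟩ ⟨Y, hY, f'⟩ ⟨g, hg⟩
        obtain rfl : X = Y := by omega
        exact ⟨g⁻¹, by simp only at hg; simp [hg]⟩
      trans := by
        rintro ⟨X, hX, f⟩ ⟨Y, hY, f'⟩ ⟨Z, hZ, f''⟩ ⟨g, hg⟩ ⟨g', hg'⟩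
        obtain rfl : X = Y := by omega
        exact ⟨g' * g, by simp only at hg hg'; simp [hg, hg', mul_assoc]⟩ }

/-- The pair `(0, x)` given by an automorphism `x` of `n` in `β`. -/
def ofBraid {n : ℕ} (x : BraidGroup n) : BracketPair n n := ⟨0, zero_add n, x⟩

/-- `(Y, g) ∘ (X, f) = (Y ♮ X, g ∘ (id_Y ♮ f))`. -/
def comp {l m n : ℕ} (P : BracketPair l m) (Q : BracketPair m n) : BracketPair l n :=
  ⟨Q.X + P.X, by have := P.add_eq; have := Q.add_eq; omega,
    Q.f * BraidGroup.shift Q.X Q.add_eq.le P.f⟩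

theorem comp_congr {l m n : ℕ} (P P' : BracketPair l m) (Q Q' : BracketPair m n)
    (hP : P ≈ P') (hQ : Q ≈ Q') : P.comp Q ≈ P'.comp Q' := by
  obtain ⟨X, hX, f⟩ := P
  obtain ⟨X', hX', f'⟩ := P'
  obtain ⟨Y, hY, g⟩ := Q
  obtain ⟨Y', hY', g'⟩ := Q'
  obtain rfl : X = X' := by omega
  obtain rfl : Y = Y' := by omega
  obtain ⟨u, hu⟩ := hP
  obtain ⟨v, hv⟩ := hQ
  change BraidGroup X at u
  change BraidGroup Y at v
  have hu' : f = f' * BraidGroup.shift 0 (by omega) u := hu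
  clear hu
  have hv' : g = g' * BraidGroup.shift 0 (by omega) v := hv
  clear hv
  refine ⟨BraidGroup.shift 0 (by simp only [comp]; omega) v *
    BraidGroup.shift Y (by simp only [comp]; omega) u, ?_⟩
  subst hu' hv'
  change g' * BraidGroup.shift 0 (by omega : 0 + Y ≤ n) v *
      BraidGroup.shift Y hY.le (f' * BraidGroup.shift 0 (by omega : 0 + X ≤ m) u) =
    g' * BraidGroup.shift Y hY.le f' * BraidGroup.shift 0 (by omega : 0 + (Y + X) ≤ n)
      (BraidGroup.shift 0 (by omega : 0 + Y ≤ Y + X) v *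
        BraidGroup.shift Y (by omega : Y + X ≤ Y + X) u)
  simp only [map_mul, BraidGroup.shift_shift, zero_add, add_zero]
  have h := BraidGroup.shift_comm (n := n) 0 Y (by omega) hY.le v f'
  rw [mul_assoc, mul_assoc, ← mul_assoc (BraidGroup.shift 0 _ v), h]
  simp only [mul_assoc]

end BracketPair

/-- Objects of Quillen's bracket construction `𝔘β` on the braid groupoid: the natural numbers. -/
structure UBeta where
  /-- the number of strands -/
  strands : ℕ

/-- Quillen's bracket construction `𝔘β` on the braid groupoid `(β, ♮, 0)`: a morphism `m ⟶ n` is an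
element `[X, f]` of `colim_{X ∈ β} Hom_β (X ♮ m, n)`, and
`[Y, g] ∘ [X, f] = [Y ♮ X, g ∘ (id_Y ♮ f)]`. -/
instance : SmallCategory UBeta where
  Hom m n := Quotient (BracketPair.setoid m.strands n.strands)
  id _ := ⟦BracketPair.ofBraid 1⟧
  comp p q := Quotient.map₂ BracketPair.comp
    (fun P P' hP Q Q' hQ => BracketPair.comp_congr P P' Q Q' hP hQ) p q
  id_comp p := by
    induction p using Quotient.inductionOn with
    | h P => exact Quotient.sound ⟨1, by simp [BracketPair.comp, BracketPair.ofBraid]; exact map_one (BraidGroup.shift _ _)⟩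
  comp_id p := by
    induction p using Quotient.inductionOn with
    | h P => exact Quotient.sound ⟨1, by simp [BracketPair.comp, BracketPair.ofBraid]; exact map_one (BraidGroup.shift _ _)⟩
  assoc p q r := by
    induction p using Quotient.inductionOn with
    | h P =>
      induction q using Quotient.inductionOn with
      | h Q =>
        induction r using Quotient.inductionOn with
        | h R =>
          refine Quotient.sound ⟨1, ?_⟩
          simp [BracketPair.comp, BraidGroup.shift_shift, mul_assoc]; exact map_one (BraidGroup.shift _ _)

namespace BracketPair

/-- The morphism `[X, f]` of `𝔘β`. -/
def hom {m n : ℕ} (P : BracketPair m n) : (⟨m⟩ : UBeta) ⟶ ⟨n⟩ := Quotient.mk _ P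

theorem hom_comp {l m n : ℕ} (P : BracketPair l m) (Q : BracketPair m n) :
    (P.comp Q).hom = P.hom ≫ Q.hom := rfl

theorem hom_ofBraid_one (n : ℕ) : (ofBraid (1 : BraidGroup n)).hom = 𝟙 (⟨n⟩ : UBeta) := rfl

theorem ofBraid_hom_mul {n : ℕ} (x y : BraidGroup n) :
    (ofBraid (x * y)).hom = (ofBraid y).hom ≫ (ofBraid x).hom :=
  Quotient.sound ⟨1, by simp [comp, ofBraid]; exact map_one (BraidGroup.shift _ _)⟩

/-- The injection `j ↦ 𝔭(f)(X + j)` underlying `[X, f]`. -/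
def toInj {m n : ℕ} (P : BracketPair m n) : Fin m ↪ Fin n where
  toFun j := BraidGroup.toPerm n P.f ⟨P.X + j, by have := P.add_eq; omega⟩
  inj' i j h := by
    have := congrArg Fin.val ((BraidGroup.toPerm n P.f).injective h)
    simp only at this
    exact Fin.ext (by omega)

theorem toInj_apply {m n : ℕ} (P : BracketPair m n) (j : Fin m) :
    P.toInj j = BraidGroup.toPerm n P.f ⟨P.X + j, by have := P.add_eq; omega⟩ := rfl

theorem toInj_ofBraid_one (n : ℕ) :
    (ofBraid (1 : BraidGroup n)).toInj = Function.Embedding.refl _ := by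
  ext j
  simp [toInj, ofBraid]

theorem toInj_comp {l m n : ℕ} (P : BracketPair l m) (Q : BracketPair m n) :
    (P.comp Q).toInj = P.toInj.trans Q.toInj := by
  ext j
  have hP := P.add_eq
  have hQ := Q.add_eq
  rw [Function.Embedding.trans_apply, toInj_apply, toInj_apply, toInj_apply]
  change (BraidGroup.toPerm n (Q.f * BraidGroup.shift Q.X Q.add_eq.le P.f) _ : ℕ) = _
  rw [map_mul, Equiv.Perm.mul_apply,
    ← BraidGroup.toPerm_shift Q.X Q.add_eq.le P.f ⟨P.X + j, by omega⟩]
  simp only [comp, add_assoc]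

theorem toInj_eq_of_equiv {m n : ℕ} {P Q : BracketPair m n} (h : P ≈ Q) :
    P.toInj = Q.toInj := by
  obtain ⟨X, hX, f⟩ := P
  obtain ⟨Y, hY, f'⟩ := Q
  obtain rfl : X = Y := by omega
  obtain ⟨u, hu⟩ := h
  change BraidGroup X at u
  have hu' : f = f' * BraidGroup.shift 0 (by omega) u := hu
  clear hu
  subst hu'
  ext j
  rw [toInj_apply, toInj_apply]
  simp only [map_mul, Equiv.Perm.mul_apply]
  rw [BraidGroup.toPerm_shift_of_lt 0 _ u _ (Or.inr (by simp))]

/-- Every injection underlies a morphism of `𝔘β`. -/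
theorem toInj_surjective (m n : ℕ) :
    Function.Surjective (toInj : BracketPair m n → (Fin m ↪ Fin n)) := by
  intro φ
  have hmn : m ≤ n := by simpa using Fintype.card_le_of_embedding φ
  let ψ : Fin m ↪ Fin n := ⟨fun j => ⟨n - m + j, by omega⟩, fun i j h => by
    simp only [Fin.mk.injEq] at h
    exact Fin.ext (by omega)⟩
  let e : Set.range ψ ≃ Set.range φ :=
    (Equiv.ofInjective ψ ψ.injective).symm.trans (Equiv.ofInjective φ φ.injective)
  obtain ⟨x, hx⟩ := BraidGroup.toPerm_surjective n (e.extendSubtype)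
  refine ⟨⟨n - m, by omega, x⟩, ?_⟩
  ext j
  simp only [toInj, Function.Embedding.coeFn_mk, hx]
  have h1 : (⟨n - m + j, by omega⟩ : Fin n) = ψ j := rfl
  have h2 : (Equiv.ofInjective ψ ψ.injective).symm ⟨ψ j, Set.mem_range_self j⟩ = j := by
    rw [Equiv.symm_apply_eq]; rfl
  rw [h1, Equiv.extendSubtype_apply_of_mem e (ψ j) (Set.mem_range_self j)]
  simp [e, h2]

/-- Two morphisms of `𝔘β` have the same underlying injection if and only if they differ by
composition with a pure braid; here is the non-trivial implication. -/
theorem exists_pure_of_toInj_eq {m n : ℕ} {P Q : BracketPair m n} (h : P.toInj = Q.toInj) :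
    ∃ x : PureBraidGroup n, P ≈ ⟨Q.X, Q.add_eq, x * Q.f⟩ := by
  obtain ⟨X, hX, f⟩ := P
  obtain ⟨Y, hY, f'⟩ := Q
  obtain rfl : X = Y := by omega
  let τ : Equiv.Perm (Fin n) := BraidGroup.toPerm n (f'⁻¹ * f)
  have hτ : ∀ p : Fin n, X ≤ p → τ p = p := by
    intro p hp
    have hq : BraidGroup.toPerm n f p = BraidGroup.toPerm n f' p := by
      have := DFunLike.congr_fun h ⟨p - X, by omega⟩
      simp only [toInj_apply, Nat.add_sub_cancel' hp] at this
      exact this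
    simp [τ, hq]
  have hlt : ∀ p : Fin n, (p : ℕ) < X → (τ p : ℕ) < X := by
    intro p hp
    by_contra hc
    have h1 := τ.injective (hτ (τ p) (by omega))
    rw [h1] at hc
    exact hc hp
  let c : Fin X → Fin X := fun i => ⟨τ ⟨i, by omega⟩, hlt _ i.2⟩
  have hc : Function.Injective c := by
    intro i j hij
    have h1 : (τ ⟨i, by omega⟩ : ℕ) = τ ⟨j, by omega⟩ := congrArg (Fin.val (n := X)) hij
    have h2 := τ.injective (Fin.ext h1)
    exact Fin.ext (congrArg (Fin.val (n := n)) h2)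
  obtain ⟨u, hu⟩ := BraidGroup.toPerm_surjective X
    (Equiv.ofBijective c (Finite.injective_iff_bijective.mp hc))
  have hs : BraidGroup.toPerm n (BraidGroup.shift 0 (by omega) u) = τ := by
    ext p
    by_cases hp : (p : ℕ) < X
    · have := BraidGroup.toPerm_shift (n := n) 0 (by omega) u ⟨p, hp⟩
      simp only [zero_add, Fin.eta] at this
      simp [this, hu, c]
    · rw [hτ p (by omega), BraidGroup.toPerm_shift_of_lt _ _ _ _ (Or.inr (by omega))]
  refine ⟨⟨f * (BraidGroup.shift 0 (by omega) u)⁻¹ * f'⁻¹, ?_⟩, u, ?_⟩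
  · change BraidGroup.toPerm n _ = 1
    rw [map_mul, map_mul, map_inv, hs]
    simp [τ]
  · simp

end BracketPair

/-- The functor `𝔓 : 𝔘β ⥤ FI` induced by the surjections of the braid groups onto the symmetric
groups. It is the identity on objects. -/
def UBeta.toFI : UBeta ⥤ FI where
  obj n := ⟨n.strands⟩
  map p := Quotient.lift BracketPair.toInj (fun _ _ h => BracketPair.toInj_eq_of_equiv h) p
  map_id n := BracketPair.toInj_ofBraid_one n.strands
  map_comp p q := by
    induction p using Quotient.inductionOn with
    | h P =>
      induction q using Quotient.inductionOn with
      | h Q => exact BracketPair.toInj_comp P Q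

/-! ### Inner automorphisms act trivially on group homology -/
/-- The pair `(conjugation by g, ρ(g))` is a morphism from `(G, A)` to itself. -/
noncomputable def repConj {k G : Type u} [CommRing k] [Group G] (A : Rep.{u} k G) (g : G) :
    A ⟶ Rep.res (MulAut.conj g).toMonoidHom A :=
  Rep.ofHom ⟨A.ρ g, fun h => by
    ext x
    simp [← Module.End.mul_apply, ← map_mul]⟩

/-- The morphism of short complexes of chain complexes induced by conjugation by `g`. -/
noncomputable def repConjShort {k G : Type u} [CommRing k] [Group G]
    (X : ShortComplex (Rep.{u} k G)) (g : G) :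
    X.map (groupHomology.chainsFunctor k G) ⟶ X.map (groupHomology.chainsFunctor k G) where
  τ₁ := groupHomology.chainsMap _ (repConj X.X₁ g)
  τ₂ := groupHomology.chainsMap _ (repConj X.X₂ g)
  τ₃ := groupHomology.chainsMap _ (repConj X.X₃ g)
  comm₁₂ := by
    refine (groupHomology.chainsMap_comp _ (MonoidHom.id G) _ _).symm.trans
      (Eq.trans ?_ (groupHomology.chainsMap_comp (MonoidHom.id G) _ _ _))
    refine groupHomology.chainsMap_congr rfl ?_
    ext x
    exact Rep.hom_comm_apply X.f g x
  comm₂₃ := by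
    refine (groupHomology.chainsMap_comp _ (MonoidHom.id G) _ _).symm.trans
      (Eq.trans ?_ (groupHomology.chainsMap_comp (MonoidHom.id G) _ _ _))
    refine groupHomology.chainsMap_congr rfl ?_
    ext x
    exact Rep.hom_comm_apply X.g g x

/-- Inner automorphisms act trivially on group homology. -/
theorem groupHomology_map_conj {k G : Type u} [CommRing k] [Group G] (g : G) (n : ℕ) :
    ∀ A : Rep.{u} k G,
      groupHomology.map (MulAut.conj g).toMonoidHom (repConj A g) n = 𝟙 (groupHomology A n) := by
  classical
  induction n with
  | zero =>
    intro A
    rw [← cancel_epi (groupHomology.H0π A), groupHomology.H0π_comp_map, Category.comp_id]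
    ext x
    have h : groupHomology.H0π A (A.ρ g x) = groupHomology.H0π A x := by
      have hx : (Rep.coinvariantsMk k G).app A (A.ρ g x) = (Rep.coinvariantsMk k G).app A x :=
        Representation.Coinvariants.mk_self_apply _ g x
      rw [← groupHomology.coinvariantsMk_comp_H0Iso_inv]
      exact congrArg (groupHomology.H0Iso A).inv hx
    exact h
  | succ n ih =>
    intro A
    let B := Rep.res (⊥ : Subgroup G).subtype A
    let P : Rep k G := Rep.ind (⊥ : Subgroup G).subtype B
    let π : P ⟶ A := (Rep.indResHomEquiv (⊥ : Subgroup G).subtype B A).symm (𝟙 B)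
    have hπ : Epi π := by
      rw [Rep.epi_iff_surjective]
      intro x
      refine ⟨Representation.IndV.mk _ _ 1 x, ?_⟩
      exact congrArg (fun f : B ⟶ Rep.res (⊥ : Subgroup G).subtype A => f.hom x)
        ((Rep.indResHomEquiv (⊥ : Subgroup G).subtype B A).apply_symm_apply (𝟙 B))
    let X : ShortComplex (Rep k G) := ShortComplex.mk (kernel.ι π) π (kernel.condition π)
    have hX : X.ShortExact := { exact := ShortComplex.exact_kernel π }
    have hz : IsZero (groupHomology X.X₂ (n + 1)) :=
      (isZero_groupHomology_succ_of_subsingleton B n).of_iso (groupHomology.indIso _ B (n + 1))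
    have := groupHomology.mono_δ_of_isZero hX n hz
    have nat := HomologicalComplex.HomologySequence.δ_naturality (repConjShort X g)
      (groupHomology.map_chainsFunctor_shortExact hX) (groupHomology.map_chainsFunctor_shortExact hX)
      (n+1) n rfl
    rw [← cancel_mono (groupHomology.δ hX (n + 1) n rfl)]
    have h2 := ih X.X₁
    erw [Category.id_comp]
    refine nat.symm.trans ?_
    refine (congrArg (groupHomology.δ hX (n + 1) n rfl ≫ ·) h2).trans ?_
    exact Category.comp_id _

/-! ### Homology of the (pure) braid groups with coefficients in a functor on `𝔘β` -/

/-- The `B_n`-action on `F(n)`: the braid `x`, an automorphism of `n` in `𝔘β`, acts by `F(x)`. -/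
def braidAction {K : Type u} [Field K] (F : UBeta ⥤ ModuleCat.{u} K) (n : ℕ) :
    Representation K (BraidGroup n) (F.obj ⟨n⟩) where
  toFun x := (F.map (BracketPair.ofBraid x).hom).hom
  map_one' := by rw [BracketPair.hom_ofBraid_one, F.map_id]; rfl
  map_mul' x y := by rw [BracketPair.ofBraid_hom_mul, F.map_comp]; rfl

/-- The `B_n`-module `F(n)`. (The group is lifted to the universe of `K`.) -/
def braidRep {K : Type u} [Field K] (F : UBeta ⥤ ModuleCat.{u} K) (n : ℕ) :
    Rep.{u} K (ULift.{u} (BraidGroup n)) :=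
  Rep.of ((braidAction F n).comp MulEquiv.ulift.toMonoidHom)

/-- The restriction of `F(n)` to the pure braid group `PB_n`. -/
def pureBraidRep {K : Type u} [Field K] (F : UBeta ⥤ ModuleCat.{u} K) (n : ℕ) :
    Rep.{u} K (ULift.{u} (PureBraidGroup n)) :=
  Rep.of (((braidAction F n).comp (PureBraidGroup n).subtype).comp MulEquiv.ulift.toMonoidHom)

/-- A homomorphism of groups, lifted to a higher universe. -/
def uliftHom {G H : Type} [Group G] [Group H] (φ : G →* H) : ULift.{u} G →* ULift.{u} H :=
  MulEquiv.ulift.symm.toMonoidHom.comp (φ.comp MulEquiv.ulift.toMonoidHom)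

namespace BracketPair

/-- The homomorphism `x ↦ f (id_X ♮ x) f⁻¹` from `B_m` to `B_n` attached to `[X, f]`. -/
def conj {m n : ℕ} (P : BracketPair m n) : BraidGroup m →* BraidGroup n :=
  (MulAut.conj P.f).toMonoidHom.comp (BraidGroup.shift P.X P.add_eq.le)

theorem conj_apply {m n : ℕ} (P : BracketPair m n) (x : BraidGroup m) :
    P.conj x = P.f * BraidGroup.shift P.X P.add_eq.le x * P.f⁻¹ := rfl

theorem conj_mem {m n : ℕ} (P : BracketPair m n) (x : PureBraidGroup m) :
    P.conj x ∈ PureBraidGroup n := by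
  have hx : BraidGroup.toPerm m x = 1 := x.2
  have hs : BraidGroup.toPerm n (BraidGroup.shift P.X P.add_eq.le x) = 1 := by
    ext p
    by_cases hp : (p : ℕ) < P.X
    · rw [BraidGroup.toPerm_shift_of_lt _ _ _ _ (Or.inl hp)]; rfl
    · have h := BraidGroup.toPerm_shift P.X P.add_eq.le (x : BraidGroup m)
        ⟨p - P.X, by have := P.add_eq; omega⟩
      simp only [hx, Equiv.Perm.coe_one, id_eq, Nat.add_sub_cancel' (not_lt.mp hp)] at h
      exact congrArg (Fin.val (n := n)) h
  change BraidGroup.toPerm n _ = 1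
  rw [conj_apply, map_mul, map_mul, hs, mul_one, map_inv, mul_inv_cancel]

/-- The restriction `PB_m →* PB_n` of `P.conj`. -/
def pureConj {m n : ℕ} (P : BracketPair m n) : PureBraidGroup m →* PureBraidGroup n :=
  (P.conj.comp (PureBraidGroup m).subtype).codRestrict (PureBraidGroup n) P.conj_mem

/-- `F([X, f])` is equivariant along `P.conj`. -/
theorem map_braidAction {K : Type u} [Field K] (F : UBeta ⥤ ModuleCat.{u} K) {m n : ℕ}
    (P : BracketPair m n) (x : BraidGroup m) (v : F.obj ⟨m⟩) :
    F.map P.hom (braidAction F m x v) = braidAction F n (P.conj x) (F.map P.hom v) := by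
  have h : (ofBraid x).hom ≫ P.hom = P.hom ≫ (ofBraid (P.conj x)).hom :=
    Quotient.sound ⟨1, by
      simp [comp, ofBraid, conj_apply]
      exact map_one (BraidGroup.shift _ _)⟩
  have h2 := congrArg F.map h
  rw [F.map_comp, F.map_comp] at h2
  exact congrArg (fun φ => φ.hom v) h2

/-- The morphism `F(m) → F(n)` of modules over `P.conj : B_m →* B_n`. -/
def braidRepHom {K : Type u} [Field K] (F : UBeta ⥤ ModuleCat.{u} K) {m n : ℕ}
    (P : BracketPair m n) : braidRep F m ⟶ Rep.res (uliftHom P.conj) (braidRep F n) :=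
  Rep.ofHom ⟨(F.map P.hom).hom, fun x => LinearMap.ext fun v => P.map_braidAction F x.down v⟩

/-- The morphism `F(m) → F(n)` of modules over `P.pureConj : PB_m →* PB_n`. -/
def pureBraidRepHom {K : Type u} [Field K] (F : UBeta ⥤ ModuleCat.{u} K) {m n : ℕ}
    (P : BracketPair m n) :
    pureBraidRep F m ⟶ Rep.res (uliftHom P.pureConj) (pureBraidRep F n) :=
  Rep.ofHom ⟨(F.map P.hom).hom, fun x => LinearMap.ext fun v => P.map_braidAction F x.down v⟩

/-- The map `H_q(B_m, F(m)) → H_q(B_n, F(n))` induced by `(P.conj, F([X, f]))`. -/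
noncomputable def braidHomologyMap {K : Type u} [Field K] (F : UBeta ⥤ ModuleCat.{u} K) (q : ℕ)
    {m n : ℕ} (P : BracketPair m n) :
    groupHomology (braidRep F m) q ⟶ groupHomology (braidRep F n) q :=
  groupHomology.map (uliftHom P.conj) (P.braidRepHom F) q

/-- The map `H_q(PB_m, F(m)) → H_q(PB_n, F(n))` induced by `(P.pureConj, F([X, f]))`. -/
noncomputable def pureBraidHomologyMap {K : Type u} [Field K] (F : UBeta ⥤ ModuleCat.{u} K)
    (q : ℕ) {m n : ℕ} (P : BracketPair m n) :
    groupHomology (pureBraidRep F m) q ⟶ groupHomology (pureBraidRep F n) q :=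
  groupHomology.map (uliftHom P.pureConj) (P.pureBraidRepHom F) q

theorem pureBraidHomologyMap_one {K : Type u} [Field K] (F : UBeta ⥤ ModuleCat.{u} K)
    (q n : ℕ) : (ofBraid (1 : BraidGroup n)).pureBraidHomologyMap F q = 𝟙 _ := by
  rw [← groupHomology.map_id]
  refine groupHomology.map_congr ?_ ?_ q
  · ext x
    change (1 * BraidGroup.shift 0 _ (x.down : BraidGroup n) * 1⁻¹ : BraidGroup n) = x.down
    rw [one_mul, inv_one, mul_one]
    exact BraidGroup.shift_self _ _
  · change (F.map (ofBraid (1 : BraidGroup n)).hom).hom = LinearMap.id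
    rw [hom_ofBraid_one, F.map_id]
    rfl

theorem pureBraidHomologyMap_comp {K : Type u} [Field K] (F : UBeta ⥤ ModuleCat.{u} K)
    (q : ℕ) {l m n : ℕ} (P : BracketPair l m) (Q : BracketPair m n) :
    (P.comp Q).pureBraidHomologyMap F q =
      P.pureBraidHomologyMap F q ≫ Q.pureBraidHomologyMap F q := by
  refine Eq.trans ?_ (groupHomology.map_comp (uliftHom P.pureConj) (uliftHom Q.pureConj)
    (P.pureBraidRepHom F) (Q.pureBraidRepHom F) q)
  refine groupHomology.map_congr ?_ ?_ q
  · ext x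
    change (P.comp Q).conj (x.down : BraidGroup l) = Q.conj (P.conj (x.down : BraidGroup l))
    simp [conj_apply, comp, BraidGroup.shift_shift, mul_assoc]
  · change (F.map (P.comp Q).hom).hom = (F.map Q.hom).hom ∘ₗ (F.map P.hom).hom
    rw [hom_comp, F.map_comp]
    rfl

/-- The induced map on the homology of the pure braid groups only depends on the underlying
injection, as inner automorphisms act trivially on group homology. -/
theorem pureBraidHomologyMap_congr {K : Type u} [Field K] (F : UBeta ⥤ ModuleCat.{u} K)
    (q : ℕ) {m n : ℕ} {P Q : BracketPair m n} (h : P.toInj = Q.toInj) :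
    P.pureBraidHomologyMap F q = Q.pureBraidHomologyMap F q := by
  obtain ⟨x, hx⟩ := exists_pure_of_toInj_eq h
  have hP : P.hom = Q.hom ≫ (ofBraid (x : BraidGroup n)).hom := by
    refine (Quotient.sound hx).trans (Quotient.sound ⟨1, ?_⟩)
    simp [comp, ofBraid]
  have hconj : ∀ y : BraidGroup m, P.conj y = x * Q.conj y * (x : BraidGroup n)⁻¹ := by
    intro y
    obtain ⟨X, hX, f⟩ := P
    obtain ⟨Y, hY, f'⟩ := Q
    obtain rfl : X = Y := by omega
    obtain ⟨u, hu⟩ := hx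
    change BraidGroup X at u
    have hu' : f = (x : BraidGroup n) * f' * BraidGroup.shift 0 (by omega : 0 + X ≤ n) u := hu
    have hc := BraidGroup.shift_comm (n := n) 0 X (by omega) hX.le u y
    rw [conj_apply, conj_apply]
    change f * BraidGroup.shift X hX.le y * f⁻¹ =
      x * (f' * BraidGroup.shift X hX.le y * f'⁻¹) * (x : BraidGroup n)⁻¹
    rw [hu', mul_assoc ((x : BraidGroup n) * f'), hc]
    group
  let g : ULift.{u} (PureBraidGroup n) := ⟨x⟩
  refine Eq.trans ?_ (Category.comp_id _)
  refine Eq.trans ?_ (congrArg (Q.pureBraidHomologyMap F q ≫ ·)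
    (groupHomology_map_conj g q (pureBraidRep F n)))
  refine Eq.trans ?_ (groupHomology.map_comp (uliftHom Q.pureConj) (MulAut.conj g).toMonoidHom
    (Q.pureBraidRepHom F) (repConj (pureBraidRep F n) g) q)
  refine groupHomology.map_congr ?_ ?_ q
  · ext y
    exact hconj (y.down : BraidGroup m)
  · change (F.map P.hom).hom = (F.map (ofBraid (x : BraidGroup n)).hom).hom ∘ₗ (F.map Q.hom).hom
    rw [hP, F.map_comp]
    rfl

end BracketPair

/-- The stable homology `H_q(B_∞, F_∞) = colim_{n ∈ (ℕ, ≤)} H_q(B_n, F(n))`. The transition map from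
`n` to `n + 1` is induced by the homomorphism `id_1 ♮ - : B_n →* B_{n+1}` and the map
`F([1, id_{n+1}]) : F(n) → F(n + 1)`. -/
noncomputable def stableBraidHomology {K : Type u} [Field K] (F : UBeta ⥤ ModuleCat.{u} K)
    (q : ℕ) : ModuleCat.{u} K :=
  colimit (Functor.ofSequence (X := fun n : ℕ => groupHomology (braidRep F n) q) fun n =>
    (⟨1, add_comm 1 n, 1⟩ : BracketPair n (n + 1)).braidHomologyMap F q)

/-- The `FI`-module `n ↦ H_q(PB_n, F(n))`: the injection underlying a morphism `[X, f] : m ⟶ n` of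
`𝔘β` acts by the map induced by `x ↦ f (id_X ♮ x) f⁻¹` and `F([X, f])`. -/
noncomputable def pureBraidHomology {K : Type u} [Field K] (F : UBeta ⥤ ModuleCat.{u} K)
    (q : ℕ) : FI ⥤ ModuleCat.{u} K where
  obj n := groupHomology (pureBraidRep F n.card) q
  map {m n} φ :=
    (Function.surjInv (BracketPair.toInj_surjective m.card n.card) φ).pureBraidHomologyMap F q
  map_id n := by
    rw [← BracketPair.pureBraidHomologyMap_one]
    refine BracketPair.pureBraidHomologyMap_congr F q ?_
    exact (Function.surjInv_eq (BracketPair.toInj_surjective _ _) _).trans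
      (BracketPair.toInj_ofBraid_one _).symm
  map_comp φ ψ := by
    rw [← BracketPair.pureBraidHomologyMap_comp]
    refine BracketPair.pureBraidHomologyMap_congr F q ?_
    rw [BracketPair.toInj_comp, Function.surjInv_eq (BracketPair.toInj_surjective _ _) (φ ≫ ψ),
      Function.surjInv_eq (BracketPair.toInj_surjective _ _) φ,
      Function.surjInv_eq (BracketPair.toInj_surjective _ _) ψ]
    rfl

/-- The defining property of the functor `pureBraidHomology F q`: composed with `𝔘β ⥤ FI`, it sends
`[X, f]` to the map induced by `[X, f]` on the homology of the pure braid groups. -/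
theorem pureBraidHomology_map_toFI {K : Type u} [Field K] (F : UBeta ⥤ ModuleCat.{u} K)
    (q : ℕ) {m n : ℕ} (P : BracketPair m n) :
    (pureBraidHomology F q).map (UBeta.toFI.map P.hom) = P.pureBraidHomologyMap F q :=
  BracketPair.pureBraidHomologyMap_congr F q (Function.surjInv_eq _ _)

/-- The `FI`-module `n ↦ H_q(PB_n, K)`, with trivial coefficients. -/
noncomputable def pureBraidHomologyTrivial (K : Type u) [Field K] (q : ℕ) :
    FI ⥤ ModuleCat.{u} K :=
  pureBraidHomology ((Functor.const UBeta).obj (ModuleCat.of K K)) q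

/-! The quotient of `B_n` by `PB_n` is finite, so its order is invertible in `K`, and `H_q(B_n,
F(n))` is the module of `B_n`-coinvariants of `H_q(PB_n, F(n))`: the corestriction is onto, and
every `B_n`-invariant map out of `H_q(PB_n, F(n))` factors through it (`epi_cores`,
`exists_cores_comp_eq`). The colimit over `FI` can then be formed in two stages. Dividing out the
automorphisms of each `n` gives `H_q(B_n, F(n))`. After that only the maps `[X, id]` matter, because
`[X, f]` is `[X, id]` followed by an automorphism, and these are composites of the steps `n → n +
1`, which gives the sequential colimit. `nonempty_stableBraidHomology_iso` turns this into two
mutually inverse maps obtained from the universal properties.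

The coinvariants statement is proved without a transfer map into `H_q(S, A)`. Its role is played by
the norm `N`, the sum over coset representatives of the conjugation action on `H_q(S, A)`. Composing
`N` with the corestriction multiplies it by the index. Surjectivity of the corestriction and the
vanishing of `N` on its kernel are proved jointly by dimension shifting (`cores_succ_of_cores`),
starting from the explicit description of `H_0`.

If `F` factors through `FI`, pure braids act trivially on `F(n)`, and over a field homology with
trivial coefficients `A` is `H_q(G, K) ⊗ A` (`trivialTensorMap_bijective`): coordinate functionals
give injectivity, and the finiteness of chains gives surjectivity. This is natural along the maps
defining the `FI`-action. -/

/-! ### Transfer for normal subgroups of finite index -/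

namespace groupHomology

/-- A projective representation is acyclic: it is a direct summand of a representation induced
from the trivial subgroup. -/
theorem isZero_succ_of_projective {k G : Type u} [CommRing k] [Group G] (A : Rep.{u} k G)
    [Projective A] (n : ℕ) : IsZero (groupHomology A (n + 1)) := by
  classical
  let B := Rep.res (⊥ : Subgroup G).subtype A
  let P : Rep k G := Rep.ind (⊥ : Subgroup G).subtype B
  let π : P ⟶ A := (Rep.indResHomEquiv (⊥ : Subgroup G).subtype B A).symm (𝟙 B)
  have hπ : Epi π := by
    rw [Rep.epi_iff_surjective]
    intro x
    refine ⟨Representation.IndV.mk _ _ 1 x, ?_⟩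
    exact congrArg (fun f : B ⟶ Rep.res (⊥ : Subgroup G).subtype A => f.hom x)
      ((Rep.indResHomEquiv (⊥ : Subgroup G).subtype B A).apply_symm_apply (𝟙 B))
  have hz : IsZero (groupHomology P (n + 1)) :=
    (isZero_groupHomology_succ_of_subsingleton B n).of_iso (groupHomology.indIso _ B (n + 1))
  -- A section of `π` exists by projectivity, so the identity of the homology of `A` factors through
  -- the zero module.
  rw [IsZero.iff_id_eq_zero, ← map_id, ← Projective.factorThru_comp (𝟙 A) π, map_id_comp,
    hz.eq_of_tgt (map (MonoidHom.id G) (Projective.factorThru (𝟙 A) π) (n + 1)) 0, zero_comp]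

/-! ### Corestriction, the conjugation action and the norm -/

section Transfer

variable {k G : Type u} [CommRing k] [Group G] (S : Subgroup G)

/-- The corestriction `H_q(S, A) → H_q(G, A)`. -/
noncomputable abbrev cores (A : Rep.{u} k G) (q : ℕ) :
    groupHomology (Rep.res S.subtype A) q ⟶ groupHomology A q :=
  map S.subtype (𝟙 _) q

/-- The morphism of short complexes of chain complexes underlying the corestrictions. -/
noncomputable def coresShort (X : ShortComplex (Rep.{u} k G)) :
    (X.map (Rep.resFunctor S.subtype)).map (chainsFunctor k S) ⟶ X.map (chainsFunctor k G) where
  τ₁ := chainsMap S.subtype (𝟙 _)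
  τ₂ := chainsMap S.subtype (𝟙 _)
  τ₃ := chainsMap S.subtype (𝟙 _)
  comm₁₂ := by
    refine (chainsMap_comp S.subtype (MonoidHom.id G) _ _).symm.trans
      (Eq.trans ?_ (chainsMap_comp (MonoidHom.id S) S.subtype _ _))
    exact chainsMap_congr rfl rfl
  comm₂₃ := by
    refine (chainsMap_comp S.subtype (MonoidHom.id G) _ _).symm.trans
      (Eq.trans ?_ (chainsMap_comp (MonoidHom.id S) S.subtype _ _))
    exact chainsMap_congr rfl rfl

theorem cores_zero_surjective (A : Rep.{u} k G) : Function.Surjective (cores S A 0) := by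
  intro y
  obtain ⟨a, rfl⟩ := (ModuleCat.epi_iff_surjective (H0π A)).1 inferInstance y
  refine ⟨H0π (Rep.res S.subtype A) a, ?_⟩
  exact congrArg (fun f => f.hom a) (H0π_comp_map S.subtype (𝟙 (Rep.res S.subtype A)))

theorem H0π_res_eq (A : Rep.{u} k G) (s : S) (a : A.V) :
    (H0π (Rep.res S.subtype A)).hom (A.ρ s a) = (H0π (Rep.res S.subtype A)).hom a := by
  rw [← coinvariantsMk_comp_H0Iso_inv]
  exact congrArg (H0Iso (Rep.res S.subtype A)).inv
    (Representation.Coinvariants.mk_self_apply (Rep.res S.subtype A).ρ s a)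

variable [S.Normal]

/-- Conjugation by `g` on `S` together with `ρ(g)` is a morphism from `(S, A)` to itself. -/
noncomputable def resConj (A : Rep.{u} k G) (g : G) :
    Rep.res S.subtype A ⟶
      Rep.res (MulAut.conjNormal g : MulAut S).toMonoidHom (Rep.res S.subtype A) :=
  Rep.ofHom ⟨A.ρ g, fun h => by
    ext x
    simp [← Module.End.mul_apply, ← map_mul]⟩

/-- The action of `g : G` on `H_q(S, A)`, for a normal subgroup `S` of `G`. -/
noncomputable abbrev conjMap (A : Rep.{u} k G) (g : G) (q : ℕ) :
    groupHomology (Rep.res S.subtype A) q ⟶ groupHomology (Rep.res S.subtype A) q :=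
  map (MulAut.conjNormal g : MulAut S).toMonoidHom (resConj S A g) q

/-- The corestriction intertwines conjugation on `S` with conjugation on `G`, and the latter is
inner, hence trivial on the homology of `G`. -/
theorem conjMap_cores (A : Rep.{u} k G) (g : G) (q : ℕ) :
    conjMap S A g q ≫ cores S A q = cores S A q := by
  refine (map_comp _ _ _ _ q).symm.trans ?_
  refine Eq.trans ?_ (Category.comp_id _)
  refine Eq.trans ?_ (congrArg (cores S A q ≫ ·) (groupHomology_map_conj g q A))
  refine Eq.trans ?_ (map_comp _ _ _ _ q)
  exact map_congr rfl rfl q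

/-- The morphism of short complexes of chain complexes underlying the action of `g`. -/
noncomputable def conjShort (X : ShortComplex (Rep.{u} k G)) (g : G) :
    (X.map (Rep.resFunctor S.subtype)).map (chainsFunctor k S) ⟶
      (X.map (Rep.resFunctor S.subtype)).map (chainsFunctor k S) where
  τ₁ := chainsMap _ (resConj S X.X₁ g)
  τ₂ := chainsMap _ (resConj S X.X₂ g)
  τ₃ := chainsMap _ (resConj S X.X₃ g)
  comm₁₂ := by
    refine (chainsMap_comp _ (MonoidHom.id S) _ _).symm.trans
      (Eq.trans ?_ (chainsMap_comp (MonoidHom.id S) _ _ _))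
    refine chainsMap_congr rfl ?_
    ext x
    exact Rep.hom_comm_apply X.f g x
  comm₂₃ := by
    refine (chainsMap_comp _ (MonoidHom.id S) _ _).symm.trans
      (Eq.trans ?_ (chainsMap_comp (MonoidHom.id S) _ _ _))
    refine chainsMap_congr rfl ?_
    ext x
    exact Rep.hom_comm_apply X.g g x

variable [S.FiniteIndex]

attribute [local instance] Subgroup.fintypeQuotientOfFiniteIndex

/-- The sum of the actions on `H_q(S, A)` of representatives of the cosets of `S`. -/
noncomputable def normMap (A : Rep.{u} k G) (q : ℕ) :
    groupHomology (Rep.res S.subtype A) q ⟶ groupHomology (Rep.res S.subtype A) q :=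
  ∑ c : G ⧸ S, conjMap S A c.out q

/-- Each summand of the norm becomes invisible after corestriction, and there are as many summands
as cosets. -/
theorem normMap_cores (A : Rep.{u} k G) (q : ℕ) :
    normMap S A q ≫ cores S A q = (S.index : k) • cores S A q := by
  rw [normMap, Preadditive.sum_comp, Finset.sum_congr rfl fun c _ => conjMap_cores S A c.out q,
    Finset.sum_const, Finset.card_univ, ← Nat.card_eq_fintype_card, Nat.cast_smul_eq_nsmul]
  rfl

/-- `∑ [g a]`, the sum being over representatives `g` of the cosets, as a function of `a`. -/
noncomputable def sumH0π (A : Rep.{u} k G) : A.V →ₗ[k] groupHomology (Rep.res S.subtype A) 0 :=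
  ∑ c : G ⧸ S, (H0π (Rep.res S.subtype A)).hom ∘ₗ A.ρ c.out

/-- Right translation by `g` permutes the cosets. The representative of the translated coset differs
from the translated representative by an element of `S`, which acts trivially in `H_0(S, A)`. -/
theorem sumH0π_ρ (A : Rep.{u} k G) (g : G) (a : A.V) :
    sumH0π S A (A.ρ g a) = sumH0π S A a := by
  simp only [sumH0π, LinearMap.sum_apply, LinearMap.comp_apply]
  refine Fintype.sum_equiv (Equiv.mulRight (g : G ⧸ S)) _ _ fun c => ?_
  have hs : c.out * g * (Equiv.mulRight (g : G ⧸ S) c).out⁻¹ ∈ S := by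
    rw [← QuotientGroup.eq_one_iff]
    simp
  rw [← H0π_res_eq S A ⟨_, hs⟩ (A.ρ _ a)]
  simp [← Module.End.mul_apply, ← map_mul]

/-- In degree zero the norm is induced by `sumH0π`, which is `G`-invariant and so descends to the
coinvariants `H_0(G, A)`. The norm therefore factors through the corestriction and vanishes on its
kernel. -/
theorem normMap_zero_eq_zero (A : Rep.{u} k G) (x : groupHomology (Rep.res S.subtype A) 0)
    (hx : cores S A 0 x = 0) : normMap S A 0 x = 0 := by
  obtain ⟨a, rfl⟩ := (ModuleCat.epi_iff_surjective (H0π (Rep.res S.subtype A))).1 inferInstance x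
  have h1 : cores S A 0 (H0π (Rep.res S.subtype A) a) = H0π A a :=
    congrArg (fun f => f.hom a) (H0π_comp_map S.subtype (𝟙 (Rep.res S.subtype A)))
  have h2 : normMap S A 0 (H0π (Rep.res S.subtype A) a) = sumH0π S A a := by
    simp only [normMap, sumH0π, ModuleCat.hom_sum, LinearMap.sum_apply, LinearMap.comp_apply]
    exact Finset.sum_congr rfl fun c _ => congrArg (fun f => f.hom a)
      (H0π_comp_map (MulAut.conjNormal c.out : MulAut S).toMonoidHom (resConj S A c.out))
  rw [h1] at hx
  rw [h2]
  have h3 : (Rep.coinvariantsMk k G).app A a = 0 := by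
    rw [← H0π_comp_H0Iso_hom]
    exact (congrArg (H0Iso A).hom hx).trans (map_zero (H0Iso A).hom.hom)
  let φ := Representation.Coinvariants.lift A.ρ (sumH0π S A)
    fun g => LinearMap.ext (sumH0π_ρ S A g)
  have h4 : φ ((Rep.coinvariantsMk k G).app A a) = sumH0π S A a := rfl
  rw [← h4, h3, map_zero]

end Transfer

/-! ### Dimension shifting and coinvariants -/

section Transfer

variable {k G : Type u} [CommRing k] [Group G] (S : Subgroup G) [S.Normal] [S.FiniteIndex]

attribute [local instance] Subgroup.fintypeQuotientOfFiniteIndex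

/-- The induction step for the comparison of `H_q(S, -)` with `H_q(G, -)`. -/
theorem cores_succ_of_cores (hk : IsUnit (S.index : k)) (q : ℕ)
    (ih : ∀ A : Rep.{u} k G, Function.Surjective (cores S A q) ∧
      ∀ x, cores S A q x = 0 → normMap S A q x = 0) (A : Rep.{u} k G) :
    Function.Surjective (cores S A (q + 1)) ∧
      ∀ x, cores S A (q + 1) x = 0 → normMap S A (q + 1) x = 0 := by
  let X : ShortComplex (Rep k G) :=
    ShortComplex.mk (kernel.ι (Projective.π A)) (Projective.π A) (kernel.condition _)
  have hX : X.ShortExact := { exact := ShortComplex.exact_kernel (Projective.π A) }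
  -- Restriction to `S` preserves projectives, so the middle term is acyclic over both groups and
  -- both connecting maps are injective.
  have hP : Projective (Rep.res S.subtype (Projective.over A)) :=
    (Rep.resFunctor S.subtype).projective_obj _
  have hXS : (X.map (Rep.resFunctor S.subtype)).ShortExact := (Rep.shortExact_res S.subtype).2 hX
  let δG : groupHomology A (q + 1) ⟶ groupHomology X.X₁ q := δ hX (q + 1) q rfl
  let δS : groupHomology (Rep.res S.subtype A) (q + 1) ⟶
      groupHomology (Rep.res S.subtype X.X₁) q := δ hXS (q + 1) q rfl
  have injG : Function.Injective δG := by
    rw [← ModuleCat.mono_iff_injective]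
    exact mono_δ_of_isZero hX q (isZero_succ_of_projective (Projective.over A) q)
  have injS : Function.Injective δS := by
    rw [← ModuleCat.mono_iff_injective]
    exact mono_δ_of_isZero hXS q
      (isZero_succ_of_projective (Rep.res S.subtype (Projective.over A)) q)
  have natδ : ∀ x, δG (cores S A (q + 1) x) = cores S X.X₁ q (δS x) := fun x =>
    congrArg (fun f => f.hom x) (HomologicalComplex.HomologySequence.δ_naturality (coresShort S X)
      (map_chainsFunctor_shortExact hXS) (map_chainsFunctor_shortExact hX) (q + 1) q rfl).symm
  have natN : ∀ x, δS (normMap S A (q + 1) x) = normMap S X.X₁ q (δS x) := fun x => by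
    simp only [normMap, ModuleCat.hom_sum, LinearMap.sum_apply, map_sum]
    exact Finset.sum_congr rfl fun c _ => congrArg (fun f => f.hom x)
      (HomologicalComplex.HomologySequence.δ_naturality (conjShort S X c.out)
        (map_chainsFunctor_shortExact hXS) (map_chainsFunctor_shortExact hXS) (q + 1) q rfl).symm
  let iG : groupHomology X.X₁ q ⟶ groupHomology X.X₂ q := map (MonoidHom.id G) X.f q
  let iS : groupHomology (Rep.res S.subtype X.X₁) q ⟶ groupHomology (Rep.res S.subtype X.X₂) q :=
    map (MonoidHom.id S) ((Rep.resFunctor S.subtype).map X.f) q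
  have nati : ∀ z, cores S X.X₂ q (iS z) = iG (cores S X.X₁ q z) := fun z =>
    congrArg (fun f => f.hom z) (((HomologicalComplex.homologyMap_comp _ _ q).symm.trans
      (congrArg (fun f => HomologicalComplex.homologyMap f q) (coresShort S X).comm₁₂.symm)).trans
      (HomologicalComplex.homologyMap_comp _ _ q))
  have natNi : ∀ z, normMap S X.X₂ q (iS z) = iS (normMap S X.X₁ q z) := fun z => by
    simp only [normMap, ModuleCat.hom_sum, LinearMap.sum_apply, map_sum]
    exact Finset.sum_congr rfl fun c _ =>
      congrArg (fun f => f.hom z) (((HomologicalComplex.homologyMap_comp _ _ q).symm.trans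
        (congrArg (fun f => HomologicalComplex.homologyMap f q)
          (conjShort S X c.out).comm₁₂.symm)).trans (HomologicalComplex.homologyMap_comp _ _ q))
  have iδ : ∀ y, iG (δG y) = 0 := fun y =>
    congrArg (fun f => f.hom y) (mapShortComplex₁ hX (j := q) rfl).zero
  have exS : ∀ z, iS z = 0 → ∃ x, δS x = z :=
    (ShortComplex.moduleCat_exact_iff _).1 (mapShortComplex₁_exact hXS (j := q) rfl)
  constructor
  · intro y
    obtain ⟨z, hz⟩ := (ih X.X₁).1 (δG y)
    -- The class `z` need not come from `H_{q+1}(S, A)`, but its norm does. The image of `z` in the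
    -- homology of the projective lies in the kernel of the corestriction, so the norm kills it.
    -- This has content only for `q = 0`, the projective being acyclic in positive degrees.
    have h1 : iS (normMap S X.X₁ q z) = 0 := by
      rw [← natNi]
      exact (ih X.X₂).2 _ (by rw [nati, hz, iδ])
    obtain ⟨x, hx⟩ := exS _ h1
    -- Taking the norm costs a factor equal to the index, which is removed below by its inverse `v`.
    have h2 : cores S A (q + 1) x = (S.index : k) • y := by
      apply injG
      rw [natδ, hx, map_smul, ← hz]
      exact congrArg (fun f => f.hom z) (normMap_cores S X.X₁ q)
    obtain ⟨v, hv⟩ := hk.exists_left_inv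
    exact ⟨v • x, by rw [map_smul, h2, smul_smul, hv, one_smul]⟩
  · intro x hx
    apply injS
    rw [natN, (ih X.X₁).2 (δS x) (by rw [← natδ, hx, map_zero]), map_zero]

theorem cores_surjective_and_normMap_eq_zero (hk : IsUnit (S.index : k)) (q : ℕ) :
    ∀ A : Rep.{u} k G, Function.Surjective (cores S A q) ∧
      ∀ x, cores S A q x = 0 → normMap S A q x = 0 := by
  induction q with
  | zero => exact fun A => ⟨cores_zero_surjective S A, normMap_zero_eq_zero S A⟩
  | succ q ih => exact cores_succ_of_cores S hk q ih

theorem epi_cores (hk : IsUnit (S.index : k)) (A : Rep.{u} k G) (q : ℕ) : Epi (cores S A q) :=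
  (ModuleCat.epi_iff_surjective _).2 (cores_surjective_and_normMap_eq_zero S hk q A).1

/-- If the index of the normal subgroup `S` is invertible in `k`, then `H_q(G, A)` is the module of
coinvariants of `G` in `H_q(S, A)`: every `G`-invariant map on the latter factors through the
corestriction. -/
theorem exists_cores_comp_eq (hk : IsUnit (S.index : k)) (A : Rep.{u} k G) (q : ℕ)
    {T : ModuleCat.{u} k} (f : groupHomology (Rep.res S.subtype A) q ⟶ T)
    (hf : ∀ g : G, conjMap S A g q ≫ f = f) : ∃ f' : groupHomology A q ⟶ T, cores S A q ≫ f' = f := by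
  have hN : normMap S A q ≫ f = (S.index : k) • f := by
    rw [normMap, Preadditive.sum_comp, Finset.sum_congr rfl fun c _ => hf c.out,
      Finset.sum_const, Finset.card_univ, ← Nat.card_eq_fintype_card, Nat.cast_smul_eq_nsmul]
    rfl
  -- On the kernel of the corestriction the norm vanishes, while `f` composed with the norm is the
  -- index times `f`. Invertibility of the index then forces `f` to vanish.
  have hker : LinearMap.ker (cores S A q).hom ≤ LinearMap.ker f.hom := by
    intro x hx
    have h1 := (cores_surjective_and_normMap_eq_zero S hk q A).2 x hx
    have h2 : f (normMap S A q x) = (S.index : k) • f x := congrArg (fun f => f.hom x) hN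
    rw [h1, map_zero] at h2
    exact (hk.smul_eq_zero.1 h2.symm)
  let e := (cores S A q).hom.quotKerEquivOfSurjective
    (cores_surjective_and_normMap_eq_zero S hk q A).1
  refine ⟨ModuleCat.ofHom (((LinearMap.ker (cores S A q).hom).liftQ f.hom hker) ∘ₗ
    e.symm.toLinearMap), ?_⟩
  ext x
  have he : e.symm (cores S A q x) = Submodule.Quotient.mk x := by
    rw [LinearEquiv.symm_apply_eq]
    rfl
  change ((LinearMap.ker (cores S A q).hom).liftQ f.hom hker) (e.symm (cores S A q x)) = f x
  rw [he]
  rfl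

end Transfer

end groupHomology

/-! ### The stable homology as a colimit over `FI` -/

section PureCores

variable {K : Type u} [Field K] (F : UBeta ⥤ ModuleCat.{u} K)

/-- The pure braid group as a subgroup of the lifted braid group. -/
def upPureBraidGroup (n : ℕ) : Subgroup (ULift.{u} (BraidGroup n)) :=
  ((BraidGroup.toPerm n).comp MulEquiv.ulift.toMonoidHom).ker

instance (n : ℕ) : (upPureBraidGroup.{u} n).Normal :=
  inferInstanceAs (MonoidHom.ker _).Normal

instance (n : ℕ) : (upPureBraidGroup.{u} n).FiniteIndex :=
  Subgroup.finiteIndex_ker _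

/-- The two incarnations of the pure braid group are isomorphic. -/
def upPureBraidGroupEquiv (n : ℕ) : upPureBraidGroup.{u} n ≃* ULift.{u} (PureBraidGroup n) where
  toFun x := ⟨⟨x.1.down, x.2⟩⟩
  invFun x := ⟨⟨x.down.1⟩, x.down.2⟩
  left_inv _ := rfl
  right_inv _ := rfl
  map_mul' _ _ := rfl

/-- The comparison isomorphism of the homology of the two incarnations of the pure braid group. -/
noncomputable def upPureBraidHomologyIso (q n : ℕ) :
    groupHomology (Rep.res (upPureBraidGroup.{u} n).subtype (braidRep F n)) q ≅
      groupHomology (pureBraidRep F n) q :=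
  groupHomology.mapIso (A := Rep.res (upPureBraidGroup.{u} n).subtype (braidRep F n))
    (B := pureBraidRep F n) (upPureBraidGroupEquiv n) (LinearEquiv.refl K (F.obj ⟨n⟩))
    (fun _ => rfl) q

/-- The map `H_q(PB_n, F(n)) → H_q(B_n, F(n))` induced by the inclusion. -/
noncomputable def pureCores (q n : ℕ) :
    groupHomology (pureBraidRep F n) q ⟶ groupHomology (braidRep F n) q :=
  groupHomology.map (uliftHom (PureBraidGroup n).subtype)
    (Rep.ofHom ⟨LinearMap.id, fun _ => rfl⟩ :
      pureBraidRep F n ⟶ Rep.res (uliftHom (PureBraidGroup n).subtype) (braidRep F n)) q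

theorem upPureBraidHomologyIso_hom_pureCores (q n : ℕ) :
    (upPureBraidHomologyIso F q n).hom ≫ pureCores F q n =
      groupHomology.cores (upPureBraidGroup.{u} n) (braidRep F n) q := by
  refine (groupHomology.map_comp _ _ _ _ q).symm.trans ?_
  exact groupHomology.map_congr rfl rfl q

/-- This identifies the conjugation action in the transfer argument with the action of the
automorphism `[0, g]` of `n` in `𝔘β`, so that coinvariants can be tested by maps of the `FI`-module.
-/
theorem conjMap_upPureBraidHomologyIso_hom (q n : ℕ) (g : ULift.{u} (BraidGroup n)) :
    groupHomology.conjMap (upPureBraidGroup.{u} n) (braidRep F n) g q ≫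
        (upPureBraidHomologyIso F q n).hom =
      (upPureBraidHomologyIso F q n).hom ≫
        (BracketPair.ofBraid g.down).pureBraidHomologyMap F q := by
  refine (groupHomology.map_comp _ _ _ _ q).symm.trans
    (Eq.trans ?_ (groupHomology.map_comp (C := pureBraidRep F n)
      (upPureBraidGroupEquiv.{u} n).toMonoidHom
      (uliftHom (BracketPair.ofBraid g.down).pureConj) _
      ((BracketPair.ofBraid g.down).pureBraidRepHom F) q))
  refine groupHomology.map_congr ?_ ?_ q
  swap; · rfl
  ext x
  change g.down * x.1.down * g.down⁻¹ =
    g.down * BraidGroup.shift 0 (zero_add n).le x.1.down * g.down⁻¹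
  rw [BraidGroup.shift_self]

theorem isUnit_index_upPureBraidGroup [CharZero K] (n : ℕ) :
    IsUnit ((upPureBraidGroup.{u} n).index : K) :=
  IsUnit.mk0 _ (Nat.cast_ne_zero.2 Subgroup.FiniteIndex.index_ne_zero)

theorem epi_pureCores [CharZero K] (q n : ℕ) : Epi (pureCores F q n) := by
  have := groupHomology.epi_cores _ (isUnit_index_upPureBraidGroup n) (braidRep F n) q
  rw [← upPureBraidHomologyIso_hom_pureCores] at this
  exact epi_of_epi (upPureBraidHomologyIso F q n).hom _

theorem exists_pureCores_comp_eq [CharZero K] (q n : ℕ) {T : ModuleCat.{u} K}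
    (f : groupHomology (pureBraidRep F n) q ⟶ T)
    (hf : ∀ g : BraidGroup n, (BracketPair.ofBraid g).pureBraidHomologyMap F q ≫ f = f) :
    ∃ f' : groupHomology (braidRep F n) q ⟶ T, pureCores F q n ≫ f' = f := by
  obtain ⟨f', hf'⟩ := groupHomology.exists_cores_comp_eq (upPureBraidGroup.{u} n)
    (isUnit_index_upPureBraidGroup n) (braidRep F n) q ((upPureBraidHomologyIso F q n).hom ≫ f)
    fun g => by
      rw [← Category.assoc, conjMap_upPureBraidHomologyIso_hom, Category.assoc, hf]
  refine ⟨f', ?_⟩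
  rw [← cancel_epi (upPureBraidHomologyIso F q n).hom, ← Category.assoc,
    upPureBraidHomologyIso_hom_pureCores, hf']

/-! ### Action of the morphisms of `𝔘β` on the homology of the braid groups -/

namespace BracketPair

theorem pureBraidHomologyMap_pureCores (q : ℕ) {m n : ℕ} (P : BracketPair m n) :
    P.pureBraidHomologyMap F q ≫ pureCores F q n = pureCores F q m ≫ P.braidHomologyMap F q := by
  refine (groupHomology.map_comp (uliftHom P.pureConj) (uliftHom (PureBraidGroup n).subtype)
    (P.pureBraidRepHom F) _ q).symm.trans (Eq.trans ?_ (groupHomology.map_comp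
      (uliftHom (PureBraidGroup m).subtype) (uliftHom P.conj) _ (P.braidRepHom F) q))
  exact groupHomology.map_congr rfl rfl q

theorem braidHomologyMap_comp (q : ℕ) {l m n : ℕ} (P : BracketPair l m) (Q : BracketPair m n) :
    (P.comp Q).braidHomologyMap F q = P.braidHomologyMap F q ≫ Q.braidHomologyMap F q := by
  refine Eq.trans ?_ (groupHomology.map_comp (uliftHom P.conj) (uliftHom Q.conj)
    (P.braidRepHom F) (Q.braidRepHom F) q)
  refine groupHomology.map_congr ?_ ?_ q
  · ext x
    change (P.comp Q).conj (x.down : BraidGroup l) = Q.conj (P.conj (x.down : BraidGroup l))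
    simp [conj_apply, comp, BraidGroup.shift_shift, mul_assoc]
  · change (F.map (P.comp Q).hom).hom = (F.map Q.hom).hom ∘ₗ (F.map P.hom).hom
    rw [hom_comp, F.map_comp]
    rfl

/-- Automorphisms of `n` in `𝔘β` act trivially on the homology of the braid group. -/
theorem braidHomologyMap_ofBraid (q : ℕ) {n : ℕ} (x : BraidGroup n) :
    (ofBraid x).braidHomologyMap F q = 𝟙 _ := by
  refine Eq.trans ?_ (groupHomology_map_conj (ULift.up.{u} x) q (braidRep F n))
  refine groupHomology.map_congr ?_ ?_ q
  swap; · rfl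
  ext y
  change x * BraidGroup.shift 0 (zero_add n).le y.down * x⁻¹ = x * y.down * x⁻¹
  rw [BraidGroup.shift_self]

/-- This splits off the automorphism part of `[X, f]`, which acts trivially on the homology of the
braid group, and leaves `[X, id]`. -/
theorem eq_comp_ofBraid {m n : ℕ} (P : BracketPair m n) :
    P = (⟨P.X, P.add_eq, 1⟩ : BracketPair m n).comp (ofBraid P.f) := by
  obtain ⟨X, hX, f⟩ := P
  simp [comp, ofBraid]

end BracketPair

/-! ### The two colimits and their comparison -/

/-- The canonical map from the `n`-th term to the stable homology. -/
noncomputable def toStableBraidHomology (q n : ℕ) :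
    groupHomology (braidRep F n) q ⟶ stableBraidHomology F q :=
  colimit.ι (Functor.ofSequence (X := fun n : ℕ => groupHomology (braidRep F n) q) fun n =>
    (⟨1, add_comm 1 n, 1⟩ : BracketPair n (n + 1)).braidHomologyMap F q) n

theorem braidHomologyMap_one_toStableBraidHomology (q n : ℕ) :
    (⟨1, add_comm 1 n, 1⟩ : BracketPair n (n + 1)).braidHomologyMap F q ≫
      toStableBraidHomology F q (n + 1) = toStableBraidHomology F q n := by
  have h := colimit.w (Functor.ofSequence (X := fun n : ℕ => groupHomology (braidRep F n) q)
    fun n => (⟨1, add_comm 1 n, 1⟩ : BracketPair n (n + 1)).braidHomologyMap F q)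
    (homOfLE (Nat.le_add_right n 1))
  rwa [Functor.ofSequence_map_homOfLE_succ] at h

/-- Maps out of the stable homology. -/
theorem exists_stableBraidHomology_desc (q : ℕ) {T : ModuleCat.{u} K}
    (f : ∀ n, groupHomology (braidRep F n) q ⟶ T)
    (hf : ∀ n, (⟨1, add_comm 1 n, 1⟩ : BracketPair n (n + 1)).braidHomologyMap F q ≫ f (n + 1) =
      f n) :
    ∃ d : stableBraidHomology F q ⟶ T, ∀ n, toStableBraidHomology F q n ≫ d = f n := by
  let c : Cocone (Functor.ofSequence (X := fun n : ℕ => groupHomology (braidRep F n) q) fun n =>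
      (⟨1, add_comm 1 n, 1⟩ : BracketPair n (n + 1)).braidHomologyMap F q) :=
    ⟨T, NatTrans.ofSequence f fun n => by
      rw [Functor.ofSequence_map_homOfLE_succ]
      exact (hf n).trans (Category.comp_id _).symm⟩
  exact ⟨colimit.desc _ c, fun n => colimit.ι_desc c n⟩

theorem stableBraidHomology_hom_ext (q : ℕ) {T : ModuleCat.{u} K}
    {f g : stableBraidHomology F q ⟶ T}
    (h : ∀ n, toStableBraidHomology F q n ≫ f = toStableBraidHomology F q n ≫ g) : f = g :=
  colimit.hom_ext h

/-- The sequential colimit only imposes compatibility with the steps `[1, id]`. Compatibility with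
every `[X, f]` follows because the braid `f` acts trivially and `[X, id]` is an `X`-fold composite
of such steps. -/
theorem BracketPair.braidHomologyMap_toStableBraidHomology (q : ℕ) {m n : ℕ}
    (P : BracketPair m n) :
    P.braidHomologyMap F q ≫ toStableBraidHomology F q n = toStableBraidHomology F q m := by
  have key : ∀ (X n : ℕ) (h : X + m = n),
      (⟨X, h, 1⟩ : BracketPair m n).braidHomologyMap F q ≫ toStableBraidHomology F q n =
        toStableBraidHomology F q m := by
    intro X
    induction X with
    | zero =>
      intro n h
      obtain rfl : m = n := by omega
      exact (congrArg (· ≫ _) (braidHomologyMap_ofBraid F q 1)).trans (Category.id_comp _)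
    | succ X ih =>
      intro n h
      obtain ⟨n, rfl⟩ : ∃ k, n = k + 1 := ⟨X + m, by omega⟩
      have hX : X + m = n := by omega
      have h1 : (⟨X + 1, h, 1⟩ : BracketPair m (n + 1)) =
          (⟨X, hX, 1⟩ : BracketPair m n).comp ⟨1, add_comm 1 n, 1⟩ := by
        simp [comp, add_comm]
      rw [h1, braidHomologyMap_comp, Category.assoc, braidHomologyMap_one_toStableBraidHomology,
        ih n hX]
  rw [P.eq_comp_ofBraid, braidHomologyMap_comp, braidHomologyMap_ofBraid, Category.comp_id]
  exact key _ _ _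

/-- The canonical map from the homology of the `n`-th pure braid group to the colimit. -/
noncomputable def toColimitPureBraidHomology (q n : ℕ) :
    groupHomology (pureBraidRep F n) q ⟶ colimit (pureBraidHomology F q) :=
  colimit.ι (pureBraidHomology F q) ⟨n⟩

theorem BracketPair.pureBraidHomologyMap_toColimit (q : ℕ) {m n : ℕ} (P : BracketPair m n) :
    P.pureBraidHomologyMap F q ≫ toColimitPureBraidHomology F q n =
      toColimitPureBraidHomology F q m := by
  rw [← pureBraidHomology_map_toFI]
  exact colimit.w (pureBraidHomology F q) (UBeta.toFI.map P.hom)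

/-- Maps out of the colimit of the homology of the pure braid groups. -/
theorem exists_colimitPureBraidHomology_desc (q : ℕ) {T : ModuleCat.{u} K}
    (f : ∀ n, groupHomology (pureBraidRep F n) q ⟶ T)
    (hf : ∀ (m n : ℕ) (P : BracketPair m n), P.pureBraidHomologyMap F q ≫ f n = f m) :
    ∃ d : colimit (pureBraidHomology F q) ⟶ T, ∀ n, toColimitPureBraidHomology F q n ≫ d = f n := by
  let c : Cocone (pureBraidHomology F q) :=
    ⟨T, { app := fun n => f n.card
          -- A morphism of `FI` acts through a chosen lift to a bracket pair, and `hf` is applied to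
          -- that lift.
          naturality := fun m n φ => (hf _ _ _).trans (Category.comp_id _).symm }⟩
  exact ⟨colimit.desc _ c, fun n => colimit.ι_desc c ⟨n⟩⟩

theorem colimitPureBraidHomology_hom_ext (q : ℕ) {T : ModuleCat.{u} K}
    {f g : colimit (pureBraidHomology F q) ⟶ T}
    (h : ∀ n, toColimitPureBraidHomology F q n ≫ f = toColimitPureBraidHomology F q n ≫ g) :
    f = g :=
  colimit.hom_ext fun n => h n.card

/-- The stable homology of the braid groups is the colimit over `FI` of the homology of the pure
braid groups. -/
theorem nonempty_stableBraidHomology_iso [CharZero K] (q : ℕ) :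
    Nonempty (stableBraidHomology F q ≅ colimit (pureBraidHomology F q)) := by
  -- Braids are automorphisms in `𝔘β`, so the map to the colimit over `FI` is `B_n`-invariant and
  -- descends to `H_q(B_n, F(n))`.
  choose f hf using fun n => exists_pureCores_comp_eq F q n (toColimitPureBraidHomology F q n)
    fun g => BracketPair.pureBraidHomologyMap_toColimit F q _
  obtain ⟨d, hd⟩ := exists_stableBraidHomology_desc F q f fun n => by
    -- Compatibility of the descended maps with the step from `n` to `n + 1` is checked on the
    -- homology of the pure braid group, which surjects onto that of the braid group.
    have := epi_pureCores F q n
    rw [← cancel_epi (pureCores F q n), ← Category.assoc,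
      ← BracketPair.pureBraidHomologyMap_pureCores, Category.assoc, hf, hf,
      BracketPair.pureBraidHomologyMap_toColimit]
  obtain ⟨e, he⟩ := exists_colimitPureBraidHomology_desc F q
    (fun n => pureCores F q n ≫ toStableBraidHomology F q n) fun m n P => by
      rw [← Category.assoc, BracketPair.pureBraidHomologyMap_pureCores, Category.assoc,
        BracketPair.braidHomologyMap_toStableBraidHomology]
  refine ⟨⟨d, e, ?_, ?_⟩⟩
  · refine stableBraidHomology_hom_ext F q fun n => ?_
    have := epi_pureCores F q n
    rw [← cancel_epi (pureCores F q n), ← Category.assoc (toStableBraidHomology F q n), hd,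
      ← Category.assoc, hf, he, Category.comp_id]
  · refine colimitPureBraidHomology_hom_ext F q fun n => ?_
    rw [← Category.assoc, he, Category.assoc, hd, hf, Category.comp_id]

end PureCores

/-! ### Group homology with trivial coefficients over a field -/

namespace groupHomology

open TensorProduct

section Trivial

variable {K G : Type u} [Field K] [Group G] {U A B C : Rep.{u} K G}

/-- A linear map between representations with trivial action. -/
def trivialHom (hA : ∀ g, A.ρ g = LinearMap.id) (hB : ∀ g, B.ρ g = LinearMap.id)
    (l : A.V →ₗ[K] B.V) : A ⟶ B :=
  Rep.ofHom ⟨l, fun g => by rw [hA, hB, LinearMap.comp_id, LinearMap.id_comp]⟩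

/-- The map on homology induced by a linear map, as a linear function of the latter. -/
noncomputable def trivialMap (hA : ∀ g, A.ρ g = LinearMap.id) (hB : ∀ g, B.ρ g = LinearMap.id)
    (q : ℕ) : (A.V →ₗ[K] B.V) →ₗ[K] (groupHomology A q →ₗ[K] groupHomology B q) where
  toFun l := (map (MonoidHom.id G) (trivialHom hA hB l) q).hom
  map_add' l l' := by
    have h : chainsMap (MonoidHom.id G) (trivialHom hA hB (l + l')) =
        chainsMap (MonoidHom.id G) (trivialHom hA hB l) +
          chainsMap (MonoidHom.id G) (trivialHom hA hB l') := by
      ext i g a x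
      simp only [HomologicalComplex.add_f_apply, chainsMap_f]
      simp [trivialHom]
    rw [map, h, HomologicalComplex.homologyMap_add]
    rfl
  map_smul' c l := by
    have h : chainsMap (MonoidHom.id G) (trivialHom hA hB (c • l)) =
        c • chainsMap (MonoidHom.id G) (trivialHom hA hB l) := by
      ext i g a x
      simp only [HomologicalComplex.smul_f_apply, chainsMap_f]
      simp [trivialHom]
    rw [map, h]
    exact congrArg ModuleCat.Hom.hom (ShortComplex.homologyMap_smul
      ((HomologicalComplex.shortComplexFunctor _ _ q).map
        (chainsMap (MonoidHom.id G) (trivialHom hA hB l))) c)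

theorem trivialMap_comp (hA : ∀ g, A.ρ g = LinearMap.id) (hB : ∀ g, B.ρ g = LinearMap.id)
    (hC : ∀ g, C.ρ g = LinearMap.id) (q : ℕ) (l : A.V →ₗ[K] B.V) (l' : B.V →ₗ[K] C.V) :
    trivialMap hA hC q (l' ∘ₗ l) = trivialMap hB hC q l' ∘ₗ trivialMap hA hB q l :=
  congrArg ModuleCat.Hom.hom
    (map_id_comp (trivialHom hA hB l) (trivialHom hB hC l') q)

theorem trivialMap_id (hA : ∀ g, A.ρ g = LinearMap.id) (q : ℕ) :
    trivialMap hA hA q LinearMap.id = LinearMap.id :=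
  congrArg ModuleCat.Hom.hom (map_id (A := A) q)

/-- A homology class is fixed by some finite rank projection of the coefficients. -/
theorem exists_finset_trivialMap_eq (hA : ∀ g, A.ρ g = LinearMap.id) (q : ℕ) {ι : Type*}
    (b : Module.Basis ι K A.V) (x : groupHomology A q) :
    ∃ I : Finset ι, trivialMap hA hA q (∑ i ∈ I, (b.coord i).smulRight (b i)) x = x := by
  classical
  induction x using groupHomology_induction_on with | h z
  -- A representing chain takes finitely many nonzero values, each with finitely many nonzero
  -- coordinates. Projecting onto the coordinates collected in `I` fixes the chain itself, hence the
  -- cycle and its class.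
  let w : (Fin q → G) →₀ A.V := iCycles A q z
  let I := w.support.biUnion fun g => (b.repr (w g)).support
  refine ⟨I, ?_⟩
  have hw : ∀ g, (∑ i ∈ I, (b.coord i).smulRight (b i)) (w g) = w g := by
    intro g
    simp only [LinearMap.sum_apply, LinearMap.smulRight_apply, Module.Basis.coord_apply]
    have h1 : (b.repr (w g)).support ⊆ I := by
      by_cases hg : w g = 0
      · simp [hg]
      · exact Finset.subset_biUnion_of_mem (fun g => (b.repr (w g)).support)
          (Finsupp.mem_support_iff.2 hg)
    conv_rhs => rw [← b.linearCombination_repr (w g), Finsupp.linearCombination_apply]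
    exact (Finsupp.sum_of_support_subset _ h1 (fun i c => c • b i) fun i _ => zero_smul _ _).symm
  let φ := trivialHom hA hA (∑ i ∈ I, (b.coord i).smulRight (b i))
  have hz : cyclesMap (MonoidHom.id G) φ q z = z := by
    apply (ModuleCat.mono_iff_injective (iCycles A q)).1 inferInstance
    have h2 : iCycles A q (cyclesMap (MonoidHom.id G) φ q z) =
        (chainsMap (MonoidHom.id G) φ).f q (iCycles A q z) :=
      congrArg (fun f => f.hom z)
        (HomologicalComplex.cyclesMap_i (chainsMap (MonoidHom.id G) φ) q)
    rw [h2]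
    have h3 : ((chainsMap (MonoidHom.id G) φ).f q).hom w =
        Finsupp.mapRange.linearMap φ.hom.toLinearMap w := by
      rw [chainsMap_id_f_hom_eq_mapRange]
    refine h3.trans (Finsupp.ext fun g => ?_)
    exact hw g
  have h4 : map (MonoidHom.id G) φ q (π A q z) = π A q (cyclesMap (MonoidHom.id G) φ q z) :=
    congrArg (fun f => f.hom z) (π_map (MonoidHom.id G) φ q)
  rw [hz] at h4
  exact h4

variable (hU : ∀ g, U.ρ g = LinearMap.id) (hA : ∀ g, A.ρ g = LinearMap.id) (ε : U.V ≃ₗ[K] K)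

/-- The map `H_q(G, U) ⊗ A → H_q(G, A)` for a trivial one-dimensional representation `U` and a
trivial representation `A`. -/
noncomputable def trivialTensorMap (q : ℕ) : groupHomology U q ⊗[K] A.V →ₗ[K] groupHomology A q :=
  TensorProduct.lift (trivialMap hU hA q ∘ₗ LinearMap.smulRightₗ ε.toLinearMap).flip

theorem trivialTensorMap_tmul (q : ℕ) (h : groupHomology U q) (v : A.V) :
    trivialTensorMap hU hA ε q (h ⊗ₜ v) = trivialMap hU hA q (ε.toLinearMap.smulRight v) h := rfl

/-- A functional on the coefficients recovers, from a class in `H_q(G, A)`, the contraction of the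
tensor it came from. For coordinate functionals this will give injectivity. On a pure tensor it
holds because following multiplication by `v` with `c` is scaling by `c v`. -/
theorem trivialMap_trivialTensorMap (q : ℕ) (c : A.V →ₗ[K] K) (x : groupHomology U q ⊗[K] A.V) :
    trivialMap hA hU q (ε.symm.toLinearMap ∘ₗ c) (trivialTensorMap hU hA ε q x) =
      TensorProduct.rid K _ (c.lTensor _ x) := by
  induction x with
  | zero => simp
  | add x y hx hy => simp [hx, hy]
  | tmul h v =>
    rw [trivialTensorMap_tmul, ← LinearMap.comp_apply, ← trivialMap_comp]
    have : (ε.symm.toLinearMap ∘ₗ c) ∘ₗ ε.toLinearMap.smulRight v = c v • LinearMap.id := by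
      ext u
      apply ε.injective
      simp [mul_comm]
    rw [this, map_smul, trivialMap_id]
    simp

theorem trivialTensorMap_bijective (q : ℕ) : Function.Bijective (trivialTensorMap hU hA ε q) := by
  classical
  let b := Module.Basis.ofVectorSpace K A.V
  constructor
  · rw [injective_iff_map_eq_zero]
    intro x hx
    -- A tensor is determined by its contractions with the coordinate functionals, and these are
    -- computed from its image, which is zero.
    apply (TensorProduct.equivFinsuppOfBasisRight b).injective
    ext i
    rw [TensorProduct.equivFinsuppOfBasisRight_apply,
      ← trivialMap_trivialTensorMap hU hA ε q (b.coord i) x, hx]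
    simp
  · intro x
    obtain ⟨I, hI⟩ := exists_finset_trivialMap_eq hA q b x
    -- Each summand is sent to the image of `x` under the rank one projection onto `b i`; their sum
    -- over `I` fixes `x`.
    refine ⟨∑ i ∈ I, trivialMap hA hU q (ε.symm.toLinearMap ∘ₗ b.coord i) x ⊗ₜ b i, ?_⟩
    conv_rhs => rw [← hI]
    rw [map_sum, map_sum, LinearMap.sum_apply]
    refine Finset.sum_congr rfl fun i _ => ?_
    rw [trivialTensorMap_tmul, ← LinearMap.comp_apply, ← trivialMap_comp]
    congr 2
    ext v
    simp

end Trivial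

/-- For fixed `v` both sides are induced by a single map on coefficients, `u ↦ ε u • β v`, over the
same `f`. The condition `hα`, that `α` respects the identifications with `K`, is what makes the two
agree. -/
theorem map_trivialTensorMap {K G H : Type u} [Field K] [Group G] [Group H] {U A : Rep.{u} K G}
    {U' A' : Rep.{u} K H} (hU : ∀ g, U.ρ g = LinearMap.id) (hA : ∀ g, A.ρ g = LinearMap.id)
    (hU' : ∀ g, U'.ρ g = LinearMap.id) (hA' : ∀ g, A'.ρ g = LinearMap.id)
    (ε : U.V ≃ₗ[K] K) (ε' : U'.V ≃ₗ[K] K) (f : G →* H) (α : U ⟶ Rep.res f U')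
    (β : A ⟶ Rep.res f A') (hα : ∀ u, ε' (α.hom u) = ε u) (q : ℕ) (h : groupHomology U q)
    (v : A.V) :
    map f β q (trivialTensorMap hU hA ε q (h ⊗ₜ v)) =
      trivialTensorMap hU' hA' ε' q (map f α q h ⊗ₜ β.hom v) := by
  have key : map (MonoidHom.id G) (trivialHom hU hA (ε.toLinearMap.smulRight v)) q ≫ map f β q =
      map f α q ≫
        map (MonoidHom.id H) (trivialHom hU' hA' (ε'.toLinearMap.smulRight (β.hom v))) q := by
    refine (map_comp _ _ _ _ q).symm.trans (Eq.trans ?_ (map_comp _ _ _ _ q))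
    refine map_congr rfl ?_ q
    ext u
    change β.hom (ε u • v) = ε' (α.hom u) • β.hom v
    rw [hα, map_smul]
  exact congrArg (fun f => f.hom h) key

end groupHomology

/-! ### Coefficients factoring through `FI` -/

section Factor

variable {K : Type u} [Field K]

/-- An isomorphism of coefficients induces an isomorphism of the homology of the pure braid
groups. -/
noncomputable def pureBraidHomologyCongr {F F' : UBeta ⥤ ModuleCat.{u} K} (α : F ≅ F') (q : ℕ) :
    pureBraidHomology F q ≅ pureBraidHomology F' q :=
  NatIso.ofComponents
    (fun n => groupHomology.mapIso (A := pureBraidRep F n.card) (B := pureBraidRep F' n.card)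
      (MulEquiv.refl _) (α.app ⟨n.card⟩).toLinearEquiv
      (fun g => congrArg ModuleCat.Hom.hom
        (α.hom.naturality (BracketPair.ofBraid (g.down : BraidGroup n.card)).hom)) q)
    fun {m n} φ => by
      let P := Function.surjInv (BracketPair.toInj_surjective m.card n.card) φ
      refine (groupHomology.map_comp (uliftHom P.pureConj) _ (P.pureBraidRepHom F) _ q).symm.trans
        (Eq.trans ?_ (groupHomology.map_comp _ (uliftHom P.pureConj) _ (P.pureBraidRepHom F') q))
      refine groupHomology.map_congr ?_ ?_ q
      · rfl
      · exact congrArg ModuleCat.Hom.hom (α.hom.naturality P.hom)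

variable (G : FI ⥤ ModuleCat.{u} K)

theorem pureBraidRep_const_ρ (n : ℕ) (g : ULift.{u} (PureBraidGroup n)) :
    (pureBraidRep ((Functor.const UBeta).obj (ModuleCat.of K K)) n).ρ g = LinearMap.id := rfl

/-- A pure braid has trivial permutation, so it becomes an identity in `FI` before `G` is applied.
-/
theorem pureBraidRep_toFI_ρ (n : ℕ) (g : ULift.{u} (PureBraidGroup n)) :
    (pureBraidRep (UBeta.toFI ⋙ G) n).ρ g = LinearMap.id := by
  have h : UBeta.toFI.map (BracketPair.ofBraid (g.down : BraidGroup n)).hom =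
      𝟙 (UBeta.toFI.obj ⟨n⟩) := by
    refine Function.Embedding.ext fun j => ?_
    have hg : BraidGroup.toPerm n (g.down : BraidGroup n) = 1 := g.down.2
    change BraidGroup.toPerm n (g.down : BraidGroup n) ⟨0 + j, _⟩ = j
    rw [hg]
    exact Fin.ext (zero_add _)
  exact congrArg ModuleCat.Hom.hom ((congrArg G.map h).trans (G.map_id _))

/-- For coefficients which factor through `FI`, the homology of the pure braid groups is the
objectwise tensor product of the homology with trivial coefficients and the coefficients. -/
noncomputable def pureBraidHomologyTensorIso (q : ℕ) :
    pureBraidHomologyTrivial K q ⊗ G ≅ pureBraidHomology (UBeta.toFI ⋙ G) q :=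
  NatIso.ofComponents
    (fun n => (LinearEquiv.ofBijective _ (groupHomology.trivialTensorMap_bijective
      (pureBraidRep_const_ρ (K := K) n.card) (pureBraidRep_toFI_ρ G n.card)
      (LinearEquiv.refl K K) q)).toModuleIso)
    fun {m n} φ => by
      let P := Function.surjInv (BracketPair.toInj_surjective m.card n.card) φ
      -- The homology factor acts through the chosen lift `P`, whereas `G` acts through `φ` itself;
      -- this equality reconciles the two.
      have hP : UBeta.toFI.map P.hom = φ :=
        Function.surjInv_eq (BracketPair.toInj_surjective m.card n.card) φ
      refine ModuleCat.hom_ext (TensorProduct.ext' fun h v => ?_)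
      refine Eq.trans ?_ (groupHomology.map_trivialTensorMap
        (pureBraidRep_const_ρ (K := K) m.card) (pureBraidRep_toFI_ρ G m.card)
        (pureBraidRep_const_ρ (K := K) n.card) (pureBraidRep_toFI_ρ G n.card)
        (LinearEquiv.refl K K) (LinearEquiv.refl K K) (uliftHom P.pureConj)
        (P.pureBraidRepHom _) (P.pureBraidRepHom _) (fun _ => rfl) q h v).symm
      have hv : G.map φ v = G.map (UBeta.toFI.map P.hom) v :=
        congrArg (fun ψ => (G.map ψ).hom v) hP.symm
      exact congrArg (fun w => groupHomology.trivialTensorMap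
        (pureBraidRep_const_ρ (K := K) n.card) (pureBraidRep_toFI_ρ G n.card)
        (LinearEquiv.refl K K) q (P.pureBraidHomologyMap _ q h ⊗ₜ[K] w)) hv

end Factor

theorem mainTheorem5 (K : Type u) [Field K] [CharZero K] (F : UBeta ⥤ ModuleCat.{u} K) (q : ℕ) :
    Nonempty (stableBraidHomology F q ≅ colimit (pureBraidHomology F q)) ∧
    ∀ G : FI ⥤ ModuleCat.{u} K, Nonempty (F ≅ UBeta.toFI ⋙ G) →
      Nonempty (stableBraidHomology F q ≅ colimit (pureBraidHomologyTrivial K q ⊗ G)) := by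
  refine ⟨nonempty_stableBraidHomology_iso F q, fun G ⟨α⟩ => ?_⟩
  obtain ⟨e⟩ := nonempty_stableBraidHomology_iso F q
  exact ⟨e ≪≫ HasColimit.isoOfNatIso
    (pureBraidHomologyCongr α q ≪≫ (pureBraidHomologyTensorIso G q).symm)⟩
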